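/- Let $K$ be a field and let $2\le k\le n$ be integers. Let $A(n,k)$ be the bound quiver algebra over $K$ of the quiver $$1\xleftarrow{\ \alpha_1\ }2\xleftarrow{\ \alpha_2\ }\cdots\xleftarrow{\ \alpha_{n-1}\ }n$$ with relations $\alpha_{i+1}\alpha_i=0$ for $1\le i\le k-2$, that is, the quotient of the path algebra by the two-sided ideal generated by these elements; here paths are composed from left to right, so $\alpha_{i+1}\alpha_i$ is the path $i+2\to i+1\to i$. Modules are right modules, and endomorphisms of a module are multiplied as $(fg)(x)=f(g(x))$. A finitely generated $A$-module $T$ is called tilting if $\operatorname{pd}_A T\le 1$, $\operatorname{Ext}^1_A(T,T)=0$, and there is a short exact sequence $0\to A\to T_0\to T_1\to 0$ with $T_0,T_1\in\operatorname{add}T$. Then the following hold. 1. For all $2\le k\le n$, $\operatorname{gl.dim}A(n,k)=k-1$. 2. For all $2\le k<n$, there is a tilting $A(n,k)$-module $T$ such that $\operatorname{End}_{A(n,k)}T\cong A(n,k+1)$ as $K$-algebras. 3. In particular, for every $n\ge 2$ there are $K$-algebras $B_0,B_1,\dots,B_{n-2}$ such that $B_0$ is isomorphic to the path algebra of the above quiver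 of type $\mathbb A_n$ (without relations) and is hereditary, $B_{i+1}$ is isomorphic to the endomorphism algebra of a tilting $B_i$-module for every $0\le i<n-2$, and $\operatorname{gl.dim}B_{n-2}=n-1$. -/

import Mathlib

open CategoryTheory

universe u

/-! ### Path algebras -/

/-- The underlying vector space of the path algebra `KQ` of a quiver `Q` with vertex type `V`:
it has the set of all paths (the trivial ones included) as a basis. -/
def PathAlgebra (K : Type u) [Field K] (V : Type) [Quiver.{0} V] : Type u :=
  (Σ a : V, Σ b : V, Quiver.Path a b) →₀ K

namespace PathAlgebra

variable (K : Type u) [Field K] {V : Type} [Quiver.{0} V]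

noncomputable instance : AddCommGroup (PathAlgebra K V) :=
  inferInstanceAs (AddCommGroup ((Σ a : V, Σ b : V, Quiver.Path a b) →₀ K))

noncomputable instance : Module K (PathAlgebra K V) :=
  inferInstanceAs (Module K ((Σ a : V, Σ b : V, Quiver.Path a b) →₀ K))

/-- The basis element of the path algebra given by a path. -/
noncomputable def ofPath {a b : V} (p : Quiver.Path a b) : PathAlgebra K V :=
  Finsupp.single (⟨a, b, p⟩ : Σ a : V, Σ b : V, Quiver.Path a b) (1 : K)

open Classical in
/-- The product of two paths, read from left to right: first `p`, then `q`, if `p` ends where `q` starts; zero otherwise. -/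
noncomputable def mulPath (p q : Σ a : V, Σ b : V, Quiver.Path a b) : PathAlgebra K V :=
  if h : p.2.1 = q.1 then
    ofPath K (p.2.2.comp (q.2.2.cast h.symm rfl))
  else 0

/-- The bilinear extension of the product of paths. -/
noncomputable def mulLinear : PathAlgebra K V →ₗ[K] PathAlgebra K V →ₗ[K] PathAlgebra K V :=
  Finsupp.linearCombination K fun p : Σ a : V, Σ b : V, Quiver.Path a b =>
    (Finsupp.linearCombination K fun q : Σ a : V, Σ b : V, Quiver.Path a b => mulPath K p q :
      PathAlgebra K V →ₗ[K] PathAlgebra K V)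

noncomputable instance : Mul (PathAlgebra K V) := ⟨fun x y => mulLinear K x y⟩

/-- The unit is the sum of the trivial paths. -/
noncomputable instance [Fintype V] : One (PathAlgebra K V) :=
  ⟨∑ a : V, ofPath K (Quiver.Path.nil : Quiver.Path a a)⟩

variable {K}

theorem mul_def (x y : PathAlgebra K V) : x * y = mulLinear K x y := rfl

theorem mulLinear_ofPath {a b c d : V} (p : Quiver.Path a b) (q : Quiver.Path c d) :
    mulLinear K (ofPath K p) (ofPath K q) = mulPath K ⟨a, b, p⟩ ⟨c, d, q⟩ := by
  have h1 : mulLinear K (ofPath K p) =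
      (Finsupp.linearCombination K fun q : Σ a : V, Σ b : V, Quiver.Path a b =>
        mulPath K ⟨a, b, p⟩ q : PathAlgebra K V →ₗ[K] PathAlgebra K V) :=
    (Finsupp.linearCombination_single K (1 : K) _).trans (one_smul K _)
  rw [h1]
  exact (Finsupp.linearCombination_single K (1 : K) _).trans (one_smul K _)

theorem ofPath_mul_ofPath {a b c : V} (p : Quiver.Path a b) (q : Quiver.Path b c) :
    ofPath K p * ofPath K q = ofPath K (p.comp q) := by
  rw [mul_def, mulLinear_ofPath, mulPath, dif_pos rfl, Quiver.Path.cast_rfl_rfl]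

theorem ofPath_mul_ofPath_of_ne {a b c d : V} (p : Quiver.Path a b) (q : Quiver.Path c d)
    (h : b ≠ c) : ofPath K p * ofPath K q = 0 := by
  rw [mul_def, mulLinear_ofPath, mulPath, dif_neg h]

theorem linearMap_ext {M : Type*} [AddCommGroup M] [Module K M] {f g : PathAlgebra K V →ₗ[K] M}
    (h : ∀ (a b : V) (p : Quiver.Path a b), f (ofPath K p) = g (ofPath K p)) : f = g :=
  Finsupp.lhom_ext' fun p => LinearMap.ext_ring (h p.1 p.2.1 p.2.2)

theorem assoc_ofPath {a b c d e f : V} (p : Quiver.Path a b) (q : Quiver.Path c d)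
    (r : Quiver.Path e f) :
    ofPath K p * ofPath K q * ofPath K r = ofPath K p * (ofPath K q * ofPath K r) := by
  by_cases h1 : b = c
  · subst h1
    by_cases h2 : d = e
    · subst h2
      simp only [ofPath_mul_ofPath, Quiver.Path.comp_assoc]
    · rw [ofPath_mul_ofPath, ofPath_mul_ofPath_of_ne _ _ h2, ofPath_mul_ofPath_of_ne _ _ h2]
      exact (map_zero (mulLinear K (ofPath K p))).symm
  · have h0 : ofPath K p * ofPath K q = 0 := ofPath_mul_ofPath_of_ne _ _ h1
    have hz : ∀ y : PathAlgebra K V, 0 * y = 0 := fun y => by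
      rw [mul_def, map_zero, LinearMap.zero_apply]
    rw [h0, hz]
    by_cases h2 : d = e
    · subst h2
      rw [ofPath_mul_ofPath, ofPath_mul_ofPath_of_ne _ _ h1]
    · rw [ofPath_mul_ofPath_of_ne _ _ h2]
      exact (map_zero (mulLinear K (ofPath K p))).symm

theorem assoc_aux (x y z : PathAlgebra K V) : x * y * z = x * (y * z) := by
  have key : (mulLinear K (V := V)).compr₂ (mulLinear K) =
      ((LinearMap.llcomp K (PathAlgebra K V) (PathAlgebra K V) (PathAlgebra K V)).flip.comp
        (mulLinear K)).flip.comp (mulLinear K) := by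
    refine linearMap_ext fun a b p => linearMap_ext fun c d q => linearMap_ext fun e f r => ?_
    exact assoc_ofPath p q r
  exact LinearMap.congr_fun (LinearMap.congr_fun (LinearMap.congr_fun key x) y) z

theorem one_mul_aux [Fintype V] (x : PathAlgebra K V) : 1 * x = x := by
  have key : mulLinear K (1 : PathAlgebra K V) = LinearMap.id := by
    refine linearMap_ext fun a b p => ?_
    change mulLinear K (∑ c : V, ofPath K (Quiver.Path.nil : Quiver.Path c c)) (ofPath K p) = _
    rw [map_sum, LinearMap.sum_apply, Finset.sum_eq_single a]
    · exact (ofPath_mul_ofPath _ _).trans (by rw [Quiver.Path.nil_comp]; rfl)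
    · exact fun c _ hc => ofPath_mul_ofPath_of_ne _ _ hc
    · exact fun h => absurd (Finset.mem_univ a) h
  exact LinearMap.congr_fun key x

theorem mul_one_aux [Fintype V] (x : PathAlgebra K V) : x * 1 = x := by
  have key : (mulLinear K).flip (1 : PathAlgebra K V) = LinearMap.id := by
    refine linearMap_ext fun a b p => ?_
    change mulLinear K (ofPath K p) (∑ c : V, ofPath K (Quiver.Path.nil : Quiver.Path c c)) = _
    rw [map_sum, Finset.sum_eq_single b]
    · exact (ofPath_mul_ofPath _ _).trans (by rw [Quiver.Path.comp_nil]; rfl)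
    · exact fun c _ hc => ofPath_mul_ofPath_of_ne _ _ hc.symm
    · exact fun h => absurd (Finset.mem_univ b) h
  exact LinearMap.congr_fun key x

noncomputable instance [Fintype V] : Ring (PathAlgebra K V) where
  __ := (inferInstance : AddCommGroup (PathAlgebra K V))
  left_distrib x y z := map_add (mulLinear K x) y z
  right_distrib x y z := LinearMap.congr_fun (map_add (mulLinear K) x y) z
  zero_mul x := LinearMap.congr_fun (map_zero (mulLinear K)) x
  mul_zero x := map_zero (mulLinear K x)
  mul_assoc := assoc_aux
  one_mul := one_mul_aux
  mul_one := mul_one_aux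

noncomputable instance [Fintype V] : Algebra K (PathAlgebra K V) :=
  Algebra.ofModule (fun r x y => LinearMap.congr_fun (map_smul (mulLinear K) r x) y)
    (fun r x y => map_smul (mulLinear K x) r y)

end PathAlgebra

/-! ### The algebras `A(n, k)` -/

/-- The vertices of the linearly oriented quiver `1 ← 2 ← ⋯ ← n` of type `𝔸ₙ`; the element
`i : Fin n` stands for the vertex with label `i + 1`. -/
def LinearA (n : ℕ) : Type := Fin n

namespace LinearA

instance (n : ℕ) : Fintype (LinearA n) := inferInstanceAs (Fintype (Fin n))

/-- The label in `{1, …, n}` of a vertex. -/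
def label {n : ℕ} (a : LinearA n) : ℕ := Fin.val a + 1

/-- There is exactly one arrow `αᵢ : i + 1 ⟶ i` for each `1 ≤ i < n`, and no other arrow. -/
instance (n : ℕ) : Quiver.{0} (LinearA n) := ⟨fun a b => PLift (a.label = b.label + 1)⟩

end LinearA

/-- The zero relations of `A(n, k)`: the paths `αᵢ₊₁ αᵢ : i + 2 ⟶ i + 1 ⟶ i`, `1 ≤ i ≤ k - 2`,
that is, the paths of length two that start at a vertex with label at most `k`. -/
def zeroRelations (K : Type u) [Field K] (n k : ℕ) : Set (PathAlgebra K (LinearA n)) :=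
  {x | ∃ (a b c : LinearA n) (β : a ⟶ b) (α : b ⟶ c), a.label ≤ k ∧
    x = PathAlgebra.ofPath K β.toPath * PathAlgebra.ofPath K α.toPath}

/-- The bound quiver algebra `A(n, k)`: the path algebra of `1 ← 2 ← ⋯ ← n` modulo the two-sided
ideal generated by `α₂ α₁, …, αₖ₋₁ αₖ₋₂`. -/
abbrev BoundAlgebra (K : Type u) [Field K] (n k : ℕ) : Type u :=
  PathAlgebra K (LinearA n) ⧸ (TwoSidedIdeal.span (zeroRelations K n k)).asIdeal

/-! ### Homological notions for right modules

Right modules over `A` are modules over `Aᵐᵒᵖ`. -/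

/-- The global dimension of a ring: the supremum of the projective dimensions of its right
modules. -/
noncomputable def globalDimension (A : Type u) [Ring A] : WithBot ℕ∞ :=
  ⨆ M : ModuleCat.{u} Aᵐᵒᵖ, projectiveDimension M

/-- A ring is (right) hereditary if submodules of projective right modules are projective. -/
def IsHereditary (A : Type u) [Ring A] : Prop :=
  ∀ (P : Type u) [AddCommGroup P] [Module Aᵐᵒᵖ P], Module.Projective Aᵐᵒᵖ P →
    ∀ N : Submodule Aᵐᵒᵖ P, Module.Projective Aᵐᵒᵖ N

/-- `X` belongs to `add T`: it is a direct summand of a finite direct sum of copies of `T`. -/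
def InAdd (R : Type u) [Ring R] (T X : Type u) [AddCommGroup T] [Module R T]
    [AddCommGroup X] [Module R X] : Prop :=
  ∃ (m : ℕ) (i : X →ₗ[R] (Fin m → T)) (p : (Fin m → T) →ₗ[R] X), p ∘ₗ i = LinearMap.id

/-- (Classical) tilting right modules: finitely generated, of projective dimension at most one,
without self-extensions, and such that there is a short exact sequence
`0 → A → T₀ → T₁ → 0` with `T₀` and `T₁` in `add T`. -/
structure IsTilting (A : Type u) [Ring A] (T : Type u) [AddCommGroup T] [Module Aᵐᵒᵖ T] :
    Prop where
  finite : Module.Finite Aᵐᵒᵖ T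
  projectiveDimension_le_one : HasProjectiveDimensionLE (ModuleCat.of Aᵐᵒᵖ T) 1
  ext_self : Subsingleton (Abelian.Ext.{u} (ModuleCat.of Aᵐᵒᵖ T) (ModuleCat.of Aᵐᵒᵖ T) 1)
  coresolution : ∃ (T₀ T₁ : ModuleCat.{u} Aᵐᵒᵖ) (f : A →ₗ[Aᵐᵒᵖ] T₀) (g : T₀ →ₗ[Aᵐᵒᵖ] T₁),
    InAdd Aᵐᵒᵖ T T₀ ∧ InAdd Aᵐᵒᵖ T T₁ ∧
      Function.Injective f ∧ Function.Exact f g ∧ Function.Surjective g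

/-- `B` is isomorphic, as a `K`-algebra, to the endomorphism algebra of a tilting right
`A`-module. The product of endomorphisms is their composition, `(f g)(x) = f (g x)`. -/
def IsEndOfTilting (K : Type u) [Field K] (A B : Type u) [Ring A] [Algebra K A]
    [Ring B] [Algebra K B] : Prop :=
  ∃ (T : Type u) (_ : AddCommGroup T) (_ : Module K T) (_ : Module Aᵐᵒᵖ T)
    (_ : IsScalarTower K Aᵐᵒᵖ T),
    IsTilting A T ∧ Nonempty (Module.End Aᵐᵒᵖ T ≃ₐ[K] B)

/-!
The algebra `A(n, k)` has a basis of nonzero paths, at most one from each vertex to another, and an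
algebra with a basis that multiplies in this way, a path basis of type `(n, k)`, is isomorphic to
`A(n, k)`. So everything can be done for algebras with a path basis; vertices are counted from `0`.

Let `S(t)` be the simple module at the vertex `t` and `P(t)` its projective cover.

*Global dimension.* Every module has a filtration by vertices whose factors are direct sums of
copies of one `S(j)`. The exact sequences `0 → S(j) → P(j + 1) → S(j + 1) → 0` for `j + 1 < k` and
`0 → P(j - 1) → P(j) → S(j) → 0` for `k ≤ j` show that `S(j)` has projective dimension `j` in the
first range and at most `1` in the second one.

*Tilting.* Multiplication by paths embeds `P(k - 1), …, P(n - 2)` in `P(n - 1)`, and the tilting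
module arises from `A` by replacing these projective modules with the cokernels, shifted by one.
A homomorphism between two of its indecomposable summands is a multiple of multiplication by a path,
and the products that vanish are those for a path basis of type `(n, k + 1)`.
-/

section ShortExact

variable {R : Type u} [Ring R] {X Y Z : Type u} [AddCommGroup X] [Module R X] [AddCommGroup Y]
  [Module R Y] [AddCommGroup Z] [Module R Z] {f : X →ₗ[R] Y} {g : Y →ₗ[R] Z}

theorem shortExact_of_linearMap (hf : Function.Injective f) (hfg : Function.Exact f g)
    (hg : Function.Surjective g) :
    (ModuleCat.shortComplexOfCompEqZero f g hfg.linearMap_comp_eq_zero).ShortExact :=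
  ModuleCat.shortComplex_shortExact _ hfg hf hg

theorem hasProjectiveDimensionLT_succ_of_projective (n : ℕ) [Module.Projective R X] :
    HasProjectiveDimensionLT (ModuleCat.of R X) (n + 1) :=
  have := projective_iff_hasProjectiveDimensionLT_one.1 ((IsProjective.iff_projective X).1 ‹_›)
  hasProjectiveDimensionLT_of_ge _ 1 _ (Nat.le_add_left 1 n)

theorem hasProjectiveDimensionLT_succ_of_exact [Module.Projective R Y]
    (hf : Function.Injective f) (hfg : Function.Exact f g) (hg : Function.Surjective g) (n : ℕ)
    (hX : HasProjectiveDimensionLT (ModuleCat.of R X) n) :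
    HasProjectiveDimensionLT (ModuleCat.of R Z) (n + 1) :=
  (shortExact_of_linearMap hf hfg hg).hasProjectiveDimensionLT_X₃ n hX
    (hasProjectiveDimensionLT_succ_of_projective n)

theorem exact_finsuppMapRange (ι : Type*) (hfg : Function.Exact f g) :
    Function.Exact (Finsupp.mapRange.linearMap (α := ι) f) (Finsupp.mapRange.linearMap g) := by
  intro y
  change _ ↔ y ∈ Set.range (Finsupp.mapRange f (map_zero f))
  rw [Finsupp.range_mapRange, DFunLike.ext_iff]
  exact forall_congr' fun i => hfg (y i)

instance projective_finsupp (ι : Type*) [Module.Projective R X] :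
    Module.Projective R (ι →₀ X) := by
  classical exact .of_equiv (finsuppLequivDFinsupp R).symm

theorem hasProjectiveDimensionLT_finsupp_succ_of_exact (ι : Type u) [Module.Projective R Y]
    (hf : Function.Injective f) (hfg : Function.Exact f g) (hg : Function.Surjective g) (n : ℕ)
    (hX : HasProjectiveDimensionLT (ModuleCat.of R (ι →₀ X)) n) :
    HasProjectiveDimensionLT (ModuleCat.of R (ι →₀ Z)) (n + 1) :=
  hasProjectiveDimensionLT_succ_of_exact (Finsupp.mapRange_injective f (map_zero f) hf)
    (exact_finsuppMapRange ι hfg) (Finsupp.mapRange_surjective g (map_zero g) hg) n hX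

theorem subsingleton_ext_one_of_extends [Module.Projective R Y] {W : Type u} [AddCommGroup W]
    [Module R W] (hf : Function.Injective f) (hfg : Function.Exact f g) (hg : Function.Surjective g)
    (hW : ∀ φ : X →ₗ[R] W, ∃ ψ : Y →ₗ[R] W, ψ ∘ₗ f = φ) :
    Subsingleton (Abelian.Ext.{u} (ModuleCat.of R Z) (ModuleCat.of R W) 1) := by
  have hS := shortExact_of_linearMap hf hfg hg
  have := (IsProjective.iff_projective (R := R) Y).1 inferInstance
  refine subsingleton_of_forall_eq 0 fun x => ?_
  obtain ⟨x₁, rfl⟩ := Abelian.Ext.contravariant_sequence_exact₃ hS (ModuleCat.of R W) x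
    (Abelian.Ext.eq_zero_of_projective (P := ModuleCat.of R Y) _) (add_zero 1)
  obtain ⟨ψ, hψ⟩ := hW (Abelian.Ext.homEquiv₀ x₁).hom
  have hx₁ : x₁ = (Abelian.Ext.mk₀ (ModuleCat.ofHom f)).comp
      (Abelian.Ext.mk₀ (ModuleCat.ofHom ψ)) (zero_add 0) := by
    rw [Abelian.Ext.mk₀_comp_mk₀, ← ModuleCat.ofHom_comp, hψ, ModuleCat.ofHom_hom,
      Abelian.Ext.mk₀_homEquiv₀_apply]
  rw [hx₁]
  exact hS.extClass_comp_assoc _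

theorem isHereditary_of_globalDimension_le_one {A : Type u} [Ring A] (hA : globalDimension A ≤ 1) :
    IsHereditary A := by
  intro P _ _ hP N
  have hS := shortExact_of_linearMap N.injective_subtype (LinearMap.exact_subtype_mkQ N)
    N.mkQ_surjective
  have hquot : HasProjectiveDimensionLT (ModuleCat.of Aᵐᵒᵖ (P ⧸ N)) 2 :=
    (projectiveDimension_le_iff _ 1).1
      ((le_iSup (fun M : ModuleCat.{u} Aᵐᵒᵖ => projectiveDimension M) _).trans hA)
  rw [IsProjective.iff_projective, projective_iff_hasProjectiveDimensionLT_one]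
  exact (hS.hasProjectiveDimensionLT_X₃_iff 0 ((IsProjective.iff_projective P).1 hP)).1 hquot

end ShortExact

section FiniteProducts

variable {R : Type*} {ι : Type*} [Ring R]

theorem exact_piMap {X Y Z : ι → Type*} [∀ i, AddCommGroup (X i)] [∀ i, Module R (X i)]
    [∀ i, AddCommGroup (Y i)] [∀ i, Module R (Y i)] [∀ i, AddCommGroup (Z i)]
    [∀ i, Module R (Z i)] {f : ∀ i, X i →ₗ[R] Y i} {g : ∀ i, Y i →ₗ[R] Z i}
    (hfg : ∀ i, Function.Exact (f i) (g i)) :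
    Function.Exact (LinearMap.piMap f) (LinearMap.piMap g) := by
  intro y
  rw [LinearMap.coe_piMap, LinearMap.coe_piMap, Set.range_piMap, Set.mem_univ_pi, funext_iff]
  exact forall_congr' fun i => hfg i (y i)

variable [DecidableEq ι] {X : ι → Type*} [∀ i, AddCommGroup (X i)] [∀ i, Module R (X i)]

/-- The endomorphism of a product whose matrix has the single entry `f` in position `(a, b)`. -/
def blockEnd (a b : ι) (f : X b →ₗ[R] X a) : Module.End R (∀ i, X i) :=
  LinearMap.single R X a ∘ₗ f ∘ₗ LinearMap.proj b

theorem blockEnd_mul {a b c : ι} (f : X b →ₗ[R] X a) (g : X c →ₗ[R] X b) :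
    blockEnd a b f * blockEnd b c g = blockEnd a c (f ∘ₗ g) :=
  LinearMap.ext fun x => congrArg (fun y => Pi.single a (f y)) (Pi.single_eq_same b (g (x c)))

theorem blockEnd_mul_of_ne {a b c d : ι} (hbc : b ≠ c) (f : X b →ₗ[R] X a) (g : X d →ₗ[R] X c) :
    blockEnd a b f * blockEnd c d g = 0 := by
  refine LinearMap.ext fun x => ?_
  change Pi.single a (f (Pi.single c (g (x d)) b)) = 0
  rw [Pi.single_eq_of_ne hbc, map_zero, Pi.single_zero]

theorem blockEnd_eq_zero_iff {a b : ι} {f : X b →ₗ[R] X a} : blockEnd a b f = 0 ↔ f = 0 := by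
  refine ⟨fun h => LinearMap.ext fun x => ?_, fun h => by
    rw [blockEnd, h, LinearMap.zero_comp, LinearMap.comp_zero]⟩
  have hx := congrFun (LinearMap.congr_fun h (Pi.single b x)) a
  change Pi.single a (f (Pi.single b x b)) a = 0 at hx
  rwa [Pi.single_eq_same, Pi.single_eq_same] at hx

theorem blockEnd_smul {S : Type*} [Semiring S] [∀ i, Module S (X i)]
    [∀ i, SMulCommClass R S (X i)] (a b : ι) (κ : S) (f : X b →ₗ[R] X a) :
    blockEnd a b (κ • f) = κ • blockEnd a b f :=
  LinearMap.ext fun x => Pi.single_smul a κ (f (x b))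

variable [Fintype ι]

theorem sum_blockEnd_id : ∑ a : ι, blockEnd a a LinearMap.id = (1 : Module.End R (∀ i, X i)) := by
  refine LinearMap.ext fun x => ?_
  rw [LinearMap.sum_apply]
  exact Finset.univ_sum_single x

theorem sum_sum_blockEnd (f : Module.End R (∀ i, X i)) :
    ∑ a : ι, ∑ b : ι, blockEnd a b (.proj a ∘ₗ f ∘ₗ .single R X b) = f := by
  have hentry (a b : ι) : blockEnd a b (.proj a ∘ₗ f ∘ₗ .single R X b) =
      blockEnd a a LinearMap.id * f * blockEnd b b LinearMap.id := rfl
  simp_rw [hentry, ← Finset.mul_sum, sum_blockEnd_id, mul_one, ← Finset.sum_mul, sum_blockEnd_id,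
    one_mul]

end FiniteProducts

section HomologyOfProducts

variable {R : Type u} [Ring R] {ι : Type} {X Y : ι → Type u}
  [∀ i, AddCommGroup (X i)] [∀ i, Module R (X i)] [∀ i, AddCommGroup (Y i)] [∀ i, Module R (Y i)]
  {d : ℕ}

variable (R X) in
/-- The product of finitely many modules, with its projections and inclusions. -/
def piBicone [DecidableEq ι] : Limits.Bicone fun i => ModuleCat.of R (X i) where
  pt := ModuleCat.of R (∀ i, X i)
  π i := ModuleCat.ofHom (LinearMap.proj i)
  ι i := ModuleCat.ofHom (LinearMap.single R X i)
  ι_π i j := by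
    split_ifs with hij
    · subst hij
      exact ModuleCat.hom_ext (LinearMap.proj_comp_single_same R X i)
    · exact ModuleCat.hom_ext (LinearMap.proj_comp_single_ne R X j i (Ne.symm hij))

variable (R X) in
/-- A finite product of modules is a biproduct. -/
noncomputable def piBiconeIsBilimit [Fintype ι] [DecidableEq ι] : (piBicone R X).IsBilimit :=
  Limits.isBilimitOfTotal _ <| ModuleCat.hom_ext <| LinearMap.ext fun x => by
    rw [ModuleCat.hom_sum, LinearMap.sum_apply]
    exact Finset.univ_sum_single x

theorem subsingleton_ext_pi [Finite ι]
    (h : ∀ i j, Subsingleton (Abelian.Ext.{u} (ModuleCat.of R (X i)) (ModuleCat.of R (Y j)) d)) :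
    Subsingleton (Abelian.Ext.{u} (ModuleCat.of R (∀ i, X i)) (ModuleCat.of R (∀ i, Y i)) d) := by
  classical
  have := Fintype.ofFinite ι
  have (i : ι) : Subsingleton
      (Abelian.Ext.{u} (ModuleCat.of R (X i)) (ModuleCat.of R (∀ i, Y i)) d) :=
    have := h i
    (Abelian.Ext.addEquivBiproduct _ (piBiconeIsBilimit R Y) d).subsingleton
  exact (Abelian.Ext.biproductAddEquiv (piBiconeIsBilimit R X) _ d).subsingleton

theorem hasProjectiveDimensionLT_pi [Finite ι]
    (h : ∀ i, HasProjectiveDimensionLT (ModuleCat.of R (X i)) d) :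
    HasProjectiveDimensionLT (ModuleCat.of R (∀ i, X i)) d := by
  classical
  have := Fintype.ofFinite ι
  refine .mk fun i hi Z e => ?_
  have (j : ι) := HasProjectiveDimensionLT.subsingleton (ModuleCat.of R (X j)) d i hi Z
  exact (Abelian.Ext.biproductAddEquiv (piBiconeIsBilimit R X) Z i).subsingleton.elim e 0

theorem inAdd_pi {T : Type u} [AddCommGroup T] [Module R T] {m : ℕ} {X : Fin m → Type u}
    [∀ i, AddCommGroup (X i)] [∀ i, Module R (X i)]
    (hX : ∀ i, ∃ (f : X i →ₗ[R] T) (g : T →ₗ[R] X i), g ∘ₗ f = LinearMap.id) :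
    InAdd R T (∀ i, X i) := by
  choose f g hgf using hX
  exact ⟨m, .piMap f, .piMap g, LinearMap.ext fun x => funext fun i =>
    LinearMap.congr_fun (hgf i) (x i)⟩

end HomologyOfProducts

/-- The path from `a` to `b` exists and is nonzero in `A(n, k)`. Vertices are counted from `0`, so
the vertex with label `i` is `i - 1`; the path is zero exactly when it ends in
`b + 2 ⟶ b + 1 ⟶ b` with `b + 3 ≤ k`. -/
def IsNonzeroPath (n k a b : ℕ) : Prop :=
  b ≤ a ∧ a < n ∧ (a ≤ b + 1 ∨ k ≤ b + 2)

/-- The elements `r a b` form, after removing zeros, a basis of the algebra, and multiply like the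
paths from `a` to `b` in `A(n, k)`. The family is indexed by all pairs of natural numbers, with
value `0` where there is no path. -/
structure IsPathBasis (K : Type*) {A : Type*} [Field K] [Ring A] [Algebra K A] (n k : ℕ)
    (r : ℕ → ℕ → A) : Prop where
  ne_zero_iff {a b : ℕ} : r a b ≠ 0 ↔ IsNonzeroPath n k a b
  mul {a b c : ℕ} : c ≤ b → b ≤ a → r a b * r b c = r a c
  mul_of_ne {a b c d : ℕ} : b ≠ c → r a b * r c d = 0
  sum_eq_one : ∑ a ∈ Finset.range n, r a a = 1
  span_eq_top : Submodule.span K (Set.range (Function.uncurry r)) = ⊤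

namespace IsPathBasis

variable {K A B : Type*} [Field K] [Ring A] [Algebra K A] [Ring B] [Algebra K B] {n k : ℕ}
  {r : ℕ → ℕ → A} {s : ℕ → ℕ → B}

theorem eq_zero_iff (h : IsPathBasis K n k r) {a b : ℕ} : r a b = 0 ↔ ¬ IsNonzeroPath n k a b :=
  (not_iff_comm.1 h.ne_zero_iff).symm

theorem eq_zero_of_lt (h : IsPathBasis K n k r) {a b : ℕ} (hab : a < b) : r a b = 0 :=
  h.eq_zero_iff.2 fun hr => hab.not_ge hr.1

theorem mul_eq_ite (h : IsPathBasis K n k r) (a b c d : ℕ) :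
    r a b * r c d = if b = c ∧ d ≤ c ∧ b ≤ a then r a d else 0 := by
  split_ifs with hif
  · obtain ⟨rfl, hdb, hba⟩ := hif
    exact h.mul hdb hba
  · by_cases hbc : b = c
    · obtain hcd | hab : c < d ∨ a < b := by omega
      · rw [h.eq_zero_of_lt hcd, mul_zero]
      · rw [h.eq_zero_of_lt hab, zero_mul]
    · exact h.mul_of_ne hbc

theorem idem_mul (h : IsPathBasis K n k r) (a b : ℕ) : r a a * r a b = r a b := by
  obtain hba | hab := le_or_gt b a
  · exact h.mul hba le_rfl
  · rw [h.eq_zero_of_lt hab, mul_zero]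

theorem mul_idem (h : IsPathBasis K n k r) (a b : ℕ) : r a b * r b b = r a b := by
  obtain hba | hab := le_or_gt b a
  · exact h.mul le_rfl hba
  · rw [h.eq_zero_of_lt hab, zero_mul]

theorem idem_mul_mul_idem_of_ne (h : IsPathBasis K n k r) {a b c d : ℕ} (hne : (c, d) ≠ (a, b)) :
    r a a * r c d * r b b = 0 := by
  by_cases hac : a = c
  · have hdb : d ≠ b := fun hdb => hne (by rw [hac, hdb])
    rw [mul_assoc, h.mul_of_ne hdb, mul_zero]
  · rw [h.mul_of_ne hac, zero_mul]

theorem exists_smul_eq (h : IsPathBasis K n k r) (a b : ℕ) (x : A) :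
    ∃ κ : K, r a a * x * r b b = κ • r a b := by
  have hx : x ∈ Submodule.span K (Set.range (Function.uncurry r)) := by
    rw [h.span_eq_top]
    trivial
  induction hx using Submodule.span_induction with
  | mem x hx =>
    obtain ⟨⟨c, d⟩, rfl⟩ := hx
    change ∃ κ : K, r a a * r c d * r b b = κ • r a b
    by_cases hcd : (c, d) = (a, b)
    · obtain ⟨rfl, rfl⟩ := Prod.ext_iff.1 hcd
      exact ⟨1, by rw [h.idem_mul, h.mul_idem, one_smul]⟩
    · exact ⟨0, by rw [h.idem_mul_mul_idem_of_ne hcd, zero_smul]⟩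
  | zero => exact ⟨0, by rw [mul_zero, zero_mul, zero_smul]⟩
  | add x y _ _ hx hy =>
    obtain ⟨κ, hκ⟩ := hx
    obtain ⟨μ, hμ⟩ := hy
    exact ⟨κ + μ, by rw [mul_add, add_mul, hκ, hμ, add_smul]⟩
  | smul ν x _ hx =>
    obtain ⟨κ, hκ⟩ := hx
    exact ⟨ν * κ, by rw [mul_smul_comm, smul_mul_assoc, hκ, mul_smul]⟩

theorem exists_smul_mul_eq (h : IsPathBasis K n k r) (a b c d : ℕ) (x y : A) :
    ∃ κ : K, r a a * (x * r c d * y) * r b b = κ • (r a c * r c d * r d b) := by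
  obtain ⟨κ, hκ⟩ := h.exists_smul_eq a c x
  obtain ⟨μ, hμ⟩ := h.exists_smul_eq d b y
  refine ⟨κ * μ, ?_⟩
  calc r a a * (x * r c d * y) * r b b
      = (r a a * x * r c c) * r c d * (r d d * y * r b b) := by
        nth_rw 1 [← h.idem_mul c d, ← h.mul_idem c d]
        noncomm_ring
    _ = (κ * μ) • (r a c * r c d * r d b) := by
        rw [hκ, hμ, mul_smul_comm, smul_mul_assoc, smul_mul_assoc, smul_smul, mul_comm]

theorem linearIndependent (h : IsPathBasis K n k r) :
    LinearIndependent K fun p : {p : ℕ × ℕ // IsNonzeroPath n k p.1 p.2} => r p.1.1 p.1.2 := by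
  rw [linearIndependent_iff']
  rintro s g hg ⟨⟨a, b⟩, hab⟩ hs
  have hpick : r a a * (∑ p ∈ s, g p • r p.1.1 p.1.2) * r b b = g ⟨(a, b), hab⟩ • r a b := by
    rw [Finset.mul_sum, Finset.sum_mul, Finset.sum_eq_single_of_mem _ hs]
    · rw [mul_smul_comm, smul_mul_assoc, h.idem_mul, h.mul_idem]
    · rintro ⟨⟨c, d⟩, _⟩ _ hne
      rw [mul_smul_comm, smul_mul_assoc,
        h.idem_mul_mul_idem_of_ne (fun hcd => hne (Subtype.ext hcd)),
        smul_zero]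
  rw [hg, mul_zero, zero_mul] at hpick
  exact (smul_eq_zero.1 hpick.symm).resolve_right (h.ne_zero_iff.2 hab)

/-- The basis of an algebra formed by the nonzero members of a path basis. -/
noncomputable def basis (h : IsPathBasis K n k r) :
    Module.Basis {p : ℕ × ℕ // IsNonzeroPath n k p.1 p.2} K A :=
  .mk h.linearIndependent <| h.span_eq_top.ge.trans <| Submodule.span_le.2 <| by
    rintro _ ⟨⟨a, b⟩, rfl⟩
    by_cases hab : IsNonzeroPath n k a b
    · exact Submodule.subset_span ⟨⟨(a, b), hab⟩, rfl⟩
    · rw [Function.uncurry_apply_pair, h.eq_zero_iff.2 hab]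
      exact Submodule.zero_mem _

theorem basis_apply (h : IsPathBasis K n k r) (p : {p : ℕ × ℕ // IsNonzeroPath n k p.1 p.2}) :
    h.basis p = r p.1.1 p.1.2 :=
  Module.Basis.mk_apply _ _ p

/-- The linear map underlying `IsPathBasis.algEquiv`. -/
noncomputable def linearEquiv (hr : IsPathBasis K n k r) (hs : IsPathBasis K n k s) : A ≃ₗ[K] B :=
  hr.basis.equiv hs.basis (Equiv.refl _)

theorem linearEquiv_apply (hr : IsPathBasis K n k r) (hs : IsPathBasis K n k s) (a b : ℕ) :
    hr.linearEquiv hs (r a b) = s a b := by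
  by_cases hab : IsNonzeroPath n k a b
  · have := hr.basis.equiv_apply ⟨(a, b), hab⟩ hs.basis (Equiv.refl _)
    rwa [Equiv.refl_apply, basis_apply, basis_apply] at this
  · rw [hr.eq_zero_iff.2 hab, hs.eq_zero_iff.2 hab, map_zero]

/-- Algebras with path bases of the same type are isomorphic. -/
noncomputable def algEquiv (hr : IsPathBasis K n k r) (hs : IsPathBasis K n k s) : A ≃ₐ[K] B :=
  .ofLinearEquiv (hr.linearEquiv hs)
    (by simp_rw [← hr.sum_eq_one, ← hs.sum_eq_one, map_sum, linearEquiv_apply])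
    fun x y => by
      have hmul : (LinearMap.mul K A).compr₂ (hr.linearEquiv hs).toLinearMap =
          (LinearMap.mul K B).compl₁₂ (hr.linearEquiv hs).toLinearMap
            (hr.linearEquiv hs).toLinearMap := by
        refine hr.basis.ext fun p => hr.basis.ext fun q => ?_
        simp only [basis_apply, LinearMap.compr₂_apply, LinearMap.compl₁₂_apply,
          LinearMap.mul_apply', LinearEquiv.coe_coe, linearEquiv_apply, mul_eq_ite hr,
          mul_eq_ite hs, apply_ite (hr.linearEquiv hs), map_zero]
      exact LinearMap.congr_fun (LinearMap.congr_fun hmul x) y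

end IsPathBasis

namespace LinearA

variable {n : ℕ}

theorem val_of_hom {a b : LinearA n} (f : a ⟶ b) : Fin.val a = Fin.val b + 1 :=
  Nat.add_right_cancel f.down

theorem val_le_of_path {a b : LinearA n} (p : Quiver.Path a b) : Fin.val b ≤ Fin.val a := by
  induction p with
  | nil => exact le_rfl
  | cons _ f ih => have := val_of_hom f; omega

instance subsingleton_path (a b : LinearA n) : Subsingleton (Quiver.Path a b) where
  allEq p q := by
    induction p with
    | nil =>
      cases q with
      | nil => rfl
      | cons q f => have := val_of_hom f; have := val_le_of_path q; omega
    | @cons c d p f ih =>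
      cases q with
      | nil => have := val_of_hom f; have := val_le_of_path p; omega
      | @cons c' _ q f' =>
        have hf := val_of_hom f
        have hf' := val_of_hom f'
        obtain rfl : c = c' := Fin.ext (by omega)
        obtain rfl : f = f' := PLift.down_injective (Subsingleton.elim _ _)
        rw [ih q]

theorem nonempty_path {a b : LinearA n} (h : Fin.val b ≤ Fin.val a) :
    Nonempty (Quiver.Path a b) := by
  obtain ⟨d, hd⟩ := Nat.exists_eq_add_of_le h
  induction d generalizing b with
  | zero =>
    obtain rfl : a = b := Fin.ext (by omega)
    exact ⟨.nil⟩
  | succ d ih =>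
    let c : Fin n := ⟨Fin.val b + 1, by have := Fin.isLt a; omega⟩
    have hc : c.val = Fin.val b + 1 := rfl
    obtain ⟨p⟩ := ih (b := c) (by omega) (by omega)
    exact ⟨p.cons ⟨congrArg (· + 1) hc⟩⟩

end LinearA

namespace PathAlgebra

variable (K : Type u) [Field K] (n : ℕ)

/-- The path from `a` to `b`, with vertices counted from `0`, or zero if there is none. -/
noncomputable def pathElement (a b : ℕ) : PathAlgebra K (LinearA n) :=
  if h : b ≤ a ∧ a < n then
    ofPath K (LinearA.nonempty_path (a := (⟨a, h.2⟩ : Fin n))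
      (b := (⟨b, h.1.trans_lt h.2⟩ : Fin n)) h.1).some
  else 0

variable {n}

theorem pathElement_val {a b : LinearA n} (p : Quiver.Path a b) :
    pathElement K n (Fin.val a) (Fin.val b) = ofPath K p := by
  rw [pathElement, dif_pos ⟨LinearA.val_le_of_path p, Fin.isLt a⟩]
  exact congrArg _ ((LinearA.subsingleton_path a b).elim _ _)

theorem exists_pathElement_eq_ofPath {a b : ℕ} (hba : b ≤ a) (ha : a < n) :
    ∃ (a' b' : LinearA n) (p : Quiver.Path a' b'), Fin.val a' = a ∧ Fin.val b' = b ∧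
      pathElement K n a b = ofPath K p :=
  ⟨(⟨a, ha⟩ : Fin n), (⟨b, hba.trans_lt ha⟩ : Fin n), _, rfl, rfl, dif_pos ⟨hba, ha⟩⟩

theorem pathElement_ne_zero_iff {a b : ℕ} : pathElement K n a b ≠ 0 ↔ b ≤ a ∧ a < n := by
  refine ⟨fun h => by_contra fun hab => h (dif_neg hab), fun h => ?_⟩
  obtain ⟨a', b', p, -, -, hp⟩ := exists_pathElement_eq_ofPath K h.1 h.2
  exact hp ▸ Finsupp.single_ne_zero.2 one_ne_zero

theorem span_pathElement :
    Submodule.span K (Set.range (Function.uncurry (pathElement K n))) = ⊤ := by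
  set S := Submodule.span K (Set.range (Function.uncurry (pathElement K n)))
  have hS : S.mkQ = 0 := linearMap_ext fun a b p => (Submodule.Quotient.mk_eq_zero S).2 <|
    pathElement_val K p ▸ Submodule.subset_span ⟨(Fin.val a, Fin.val b), rfl⟩
  rw [← S.ker_mkQ, hS, LinearMap.ker_zero]

theorem isPathBasis_pathElement : IsPathBasis K n 2 (pathElement K n) where
  ne_zero_iff {a b} := by
    rw [pathElement_ne_zero_iff, IsNonzeroPath]
    omega
  mul {a b c} hcb hba := by
    by_cases ha : a < n
    · obtain ⟨a', b', p, rfl, rfl, hp⟩ := exists_pathElement_eq_ofPath K hba ha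
      obtain ⟨b'', c', q, hb, rfl, hq⟩ := exists_pathElement_eq_ofPath K hcb (hba.trans_lt ha)
      obtain rfl : b'' = b' := Fin.ext hb
      rw [hp, hq, ofPath_mul_ofPath, pathElement_val]
    · have hzero (d : ℕ) : pathElement K n a d = 0 := dif_neg fun h => ha h.2
      rw [hzero, hzero, zero_mul]
  mul_of_ne {a b c d} hbc := by
    by_cases hab : b ≤ a ∧ a < n
    · by_cases hcd : d ≤ c ∧ c < n
      · obtain ⟨a', b', p, rfl, rfl, hp⟩ := exists_pathElement_eq_ofPath K hab.1 hab.2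
        obtain ⟨c', d', q, rfl, rfl, hq⟩ := exists_pathElement_eq_ofPath K hcd.1 hcd.2
        rw [hp, hq, ofPath_mul_ofPath_of_ne p q (ne_of_apply_ne Fin.val hbc)]
      · rw [pathElement, pathElement, dif_neg hcd, mul_zero]
    · rw [pathElement, dif_neg hab, zero_mul]
  sum_eq_one := by
    rw [Finset.sum_range]
    exact Finset.sum_congr rfl fun a _ => pathElement_val K (.nil (V := LinearA n) (a := a))
  span_eq_top := span_pathElement K

variable {K} {k : ℕ}

theorem exists_pathElement_of_mem_zeroRelations {x : PathAlgebra K (LinearA n)}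
    (hx : x ∈ zeroRelations K n k) : ∃ c, c + 3 ≤ k ∧ x = pathElement K n (c + 2) c := by
  obtain ⟨a, b, c, β, α, ha, rfl⟩ := hx
  have hβ := LinearA.val_of_hom β
  have hα := LinearA.val_of_hom α
  have ha' : Fin.val a + 1 ≤ k := ha
  refine ⟨Fin.val c, by omega, ?_⟩
  rw [ofPath_mul_ofPath, ← pathElement_val, hβ, hα]

theorem pathElement_mem_zeroRelations {c : ℕ} (hn : c + 2 < n) (hk : c + 3 ≤ k) :
    pathElement K n (c + 2) c ∈ zeroRelations K n k := by
  let v (i : ℕ) (hi : i < n) : LinearA n := (⟨i, hi⟩ : Fin n)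
  let β : v (c + 2) hn ⟶ v (c + 1) (by omega) := ⟨rfl⟩
  let α : v (c + 1) (by omega) ⟶ v c (by omega) := ⟨rfl⟩
  refine ⟨_, _, _, β, α, hk, ?_⟩
  rw [ofPath_mul_ofPath]
  exact pathElement_val K (β.toPath.comp α.toPath)

theorem idem_mul_mul_idem_eq_zero_of_mem_span {a b : ℕ} (hab : IsNonzeroPath n k a b)
    {x : PathAlgebra K (LinearA n)} (hx : x ∈ TwoSidedIdeal.span (zeroRelations K n k)) :
    pathElement K n a a * x * pathElement K n b b = 0 := by
  have h := isPathBasis_pathElement K (n := n)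
  rw [TwoSidedIdeal.mem_span_iff_mem_addSubgroup_closure] at hx
  induction hx using AddSubgroup.closure_induction with
  | mem x hx =>
    obtain ⟨_, ⟨y, -, _, hs, rfl⟩, z, -, rfl⟩ := hx
    obtain ⟨c, hc, rfl⟩ := exists_pathElement_of_mem_zeroRelations hs
    obtain ⟨κ, hκ⟩ := h.exists_smul_mul_eq a b (c + 2) c y z
    obtain ⟨-, -, hab⟩ := hab
    obtain hac | hcb : a < c + 2 ∨ c < b := by omega
    · rw [hκ, h.eq_zero_of_lt hac, zero_mul, zero_mul, smul_zero]
    · rw [hκ, h.eq_zero_of_lt hcb, mul_zero, smul_zero]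
  | zero => rw [mul_zero, zero_mul]
  | add x y _ _ hx hy => rw [mul_add, add_mul, hx, hy, add_zero]
  | neg x _ hx => rw [mul_neg, neg_mul, hx, neg_zero]

end PathAlgebra

namespace BoundAlgebra

variable (K : Type u) [Field K] (n k : ℕ)

/-- The class in `A(n, k)` of the path from `a` to `b`, with vertices counted from `0`. -/
noncomputable def pathElement (a b : ℕ) : BoundAlgebra K n k :=
  Ideal.Quotient.mk _ (PathAlgebra.pathElement K n a b)

variable {K n k}

theorem pathElement_eq_zero_iff {a b : ℕ} : pathElement K n k a b = 0 ↔
    PathAlgebra.pathElement K n a b ∈ TwoSidedIdeal.span (zeroRelations K n k) :=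
  Ideal.Quotient.eq_zero_iff_mem.trans TwoSidedIdeal.mem_asIdeal

theorem pathElement_ne_zero_iff {a b : ℕ} :
    pathElement K n k a b ≠ 0 ↔ IsNonzeroPath n k a b := by
  have h := PathAlgebra.isPathBasis_pathElement K (n := n)
  refine ⟨fun hne => ?_, fun hab hzero => ?_⟩
  · obtain ⟨hba, han, -⟩ : IsNonzeroPath n 2 a b :=
      h.ne_zero_iff.1 fun hzero => hne (by rw [pathElement, hzero, map_zero])
    refine ⟨hba, han, by_contra fun hrel => hne (pathElement_eq_zero_iff.2 ?_)⟩
    rw [← h.mul (b := b + 2) (by omega) (by omega)]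
    exact TwoSidedIdeal.mul_mem_left _ _ _ <| TwoSidedIdeal.subset_span <|
      PathAlgebra.pathElement_mem_zeroRelations (by omega) (by omega)
  · have hpath := PathAlgebra.idem_mul_mul_idem_eq_zero_of_mem_span hab
      (pathElement_eq_zero_iff.1 hzero)
    rw [h.idem_mul, h.mul_idem] at hpath
    exact (PathAlgebra.pathElement_ne_zero_iff K).2 ⟨hab.1, hab.2.1⟩ hpath

theorem isPathBasis_pathElement : IsPathBasis K n k (pathElement K n k) where
  ne_zero_iff := pathElement_ne_zero_iff
  mul hcb hba := by
    simp only [pathElement, ← map_mul, (PathAlgebra.isPathBasis_pathElement K).mul hcb hba]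
  mul_of_ne hbc := by
    simp only [pathElement, ← map_mul, (PathAlgebra.isPathBasis_pathElement K).mul_of_ne hbc,
      map_zero]
  sum_eq_one := by
    simp only [pathElement, ← map_sum, (PathAlgebra.isPathBasis_pathElement K).sum_eq_one, map_one]
  span_eq_top := by
    have hspan := congrArg (Submodule.map (Ideal.Quotient.mkₐ K
      (TwoSidedIdeal.span (zeroRelations K n k)).asIdeal).toLinearMap)
      (PathAlgebra.span_pathElement K (n := n))
    rw [Submodule.map_span, ← Set.range_comp, Submodule.map_top, LinearMap.range_eq_top.2
      (Ideal.Quotient.mkₐ_surjective K _)] at hspan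
    exact hspan

end BoundAlgebra

/-! ### Modules over an algebra with a path basis -/

section RightModules

open scoped RightActions

section RightMultiplication

variable {A M N : Type*} [Ring A] [AddCommGroup M] [Module Aᵐᵒᵖ M] [AddCommGroup N] [Module Aᵐᵒᵖ N]

theorem map_smul_right (f : M →ₗ[Aᵐᵒᵖ] N) (m : M) (a : A) : f (m <• a) = f m <• a :=
  map_smul f _ m

variable (A) in
/-- The homomorphism of right modules `A → M` that sends `1` to `m`. -/
def orbitMap (m : M) : A →ₗ[Aᵐᵒᵖ] M where
  toFun a := m <• a
  map_add' a b := by rw [MulOpposite.op_add, add_smul]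
  map_smul' a b := by
    rw [RingHom.id_apply, smul_smul, MulOpposite.smul_eq_mul_unop, MulOpposite.op_mul,
      MulOpposite.op_unop]

theorem orbitMap_apply (m : M) (a : A) : orbitMap A m a = m <• a :=
  rfl

end RightMultiplication

/-- The uniserial right module `M(t, l)` generated by an element that is fixed by the trivial path
at `t` and killed by the paths from `t` to vertices below `l`: its composition factors are the
simple modules at the vertices `l ≤ c ≤ t` that are reached from `t` by a nonzero path. -/
abbrev UniserialModule {A : Type*} [Ring A] (r : ℕ → ℕ → A) (t l : ℕ) : Type _ :=
  A ⧸ Submodule.span Aᵐᵒᵖ (insert (1 - r t t) (r t '' Set.Iio l))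

namespace UniserialModule

variable {A : Type*} [Ring A] {M : Type*} [AddCommGroup M] [Module Aᵐᵒᵖ M]
  {r : ℕ → ℕ → A} {t l : ℕ}

variable (r t l) in
/-- The canonical generator of `UniserialModule r t l`. -/
def gen : UniserialModule r t l :=
  Submodule.Quotient.mk 1

theorem gen_smul (a : A) : gen r t l <• a = Submodule.Quotient.mk a := by
  rw [gen, ← Submodule.Quotient.mk_smul, op_smul_eq_mul, one_mul]

theorem exists_gen_smul (x : UniserialModule r t l) : ∃ a : A, gen r t l <• a = x := by
  obtain ⟨a, rfl⟩ := Submodule.Quotient.mk_surjective _ x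
  exact ⟨a, gen_smul a⟩

theorem gen_smul_idem : gen r t l <• r t t = gen r t l := by
  rw [gen_smul]
  exact ((Submodule.Quotient.eq _).2 (Submodule.subset_span (Set.mem_insert _ _))).symm

theorem gen_smul_of_lt {c : ℕ} (hc : c < l) : gen r t l <• r t c = 0 := by
  rw [gen_smul]
  exact (Submodule.Quotient.mk_eq_zero _).2
    (Submodule.subset_span (Set.mem_insert_of_mem _ (Set.mem_image_of_mem _ hc)))

theorem subsingleton_of_lt (ht : t < l) : Subsingleton (UniserialModule r t l) := by
  have hgen : gen r t l = 0 := by rw [← gen_smul_idem, gen_smul_of_lt ht]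
  exact subsingleton_of_forall_eq 0 fun x => by
    obtain ⟨a, rfl⟩ := exists_gen_smul x
    rw [hgen, smul_zero]

instance : Module.Finite Aᵐᵒᵖ (UniserialModule r t l) :=
  .of_surjective (LinearMap.toSpanSingleton Aᵐᵒᵖ _ (gen r t l)) fun x => by
    obtain ⟨a, rfl⟩ := exists_gen_smul x
    exact ⟨MulOpposite.op a, rfl⟩

theorem hom_ext {f g : UniserialModule r t l →ₗ[Aᵐᵒᵖ] M} (h : f (gen r t l) = g (gen r t l)) :
    f = g := by
  refine LinearMap.ext fun x => ?_
  obtain ⟨a, rfl⟩ := exists_gen_smul x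
  rw [map_smul_right, h, map_smul_right]

/-- The homomorphism from `UniserialModule r t l` that sends the generator to an element
satisfying the defining relations. -/
def desc (m : M) (hm : m <• r t t = m) (hl : ∀ c < l, m <• r t c = 0) :
    UniserialModule r t l →ₗ[Aᵐᵒᵖ] M :=
  Submodule.liftQ _ (orbitMap A m) <| Submodule.span_le.2 <| by
    rintro _ (rfl | ⟨c, hc, rfl⟩)
    · rw [SetLike.mem_coe, LinearMap.mem_ker, map_sub, orbitMap_apply, orbitMap_apply, hm,
        MulOpposite.op_one, one_smul, sub_self]
    · exact hl c hc

theorem desc_gen (m : M) (hm : m <• r t t = m) (hl : ∀ c < l, m <• r t c = 0) :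
    desc m hm hl (gen r t l) = m := by
  change orbitMap A m 1 = m
  rw [orbitMap_apply, MulOpposite.op_one, one_smul]

end UniserialModule

namespace IsPathBasis

open UniserialModule

variable {K A : Type*} [Field K] [Ring A] [Algebra K A] {n k : ℕ} {r : ℕ → ℕ → A}
  {M N : Type*} [AddCommGroup M] [Module Aᵐᵒᵖ M] [AddCommGroup N] [Module Aᵐᵒᵖ N]
  {q t l l' c : ℕ}

theorem sum_smul_idem (h : IsPathBasis K n k r) (m : M) :
    ∑ c ∈ Finset.range n, m <• r c c = m := by
  rw [← Finset.sum_smul, ← Finset.op_sum, h.sum_eq_one, MulOpposite.op_one, one_smul]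

theorem idem_mul_mul_idem_eq_zero_of_mem (h : IsPathBasis K n k r) (hc : l ≤ c) {x : A}
    (hx : x ∈ Submodule.span Aᵐᵒᵖ (insert (1 - r t t) (r t '' Set.Iio l))) :
    r t t * x * r c c = 0 := by
  induction hx using Submodule.span_induction generalizing c with
  | mem x hx =>
    obtain rfl | ⟨d, hd, rfl⟩ := hx
    · rw [mul_sub, mul_one, h.idem_mul, sub_self, zero_mul]
    · rw [h.idem_mul, h.mul_of_ne (ne_of_lt (hd.trans_le hc))]
  | zero => rw [mul_zero, zero_mul]
  | add x y _ _ hx hy => rw [mul_add, add_mul, hx hc, hy hc, add_zero]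
  | smul a x _ hx =>
    have hsum : r t t * a • x * r c c =
        ∑ d ∈ Finset.range n, r t t * x * (r d d * (a.unop * r c c)) := by
      rw [← Finset.mul_sum, ← Finset.sum_mul, h.sum_eq_one, one_mul,
        MulOpposite.smul_eq_mul_unop, ← mul_assoc, ← mul_assoc]
    rw [hsum]
    refine Finset.sum_eq_zero fun d _ => ?_
    obtain hdl | hld := lt_or_ge d l
    · obtain ⟨κ, hκ⟩ := h.exists_smul_eq d c a.unop
      rw [← mul_assoc (r d d), hκ, h.eq_zero_of_lt (hdl.trans_le hc), smul_zero, mul_zero]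
    · rw [← mul_assoc, hx hld, zero_mul]

theorem gen_smul_ne_zero_iff (h : IsPathBasis K n k r) :
    gen r t l <• r t c ≠ 0 ↔ l ≤ c ∧ IsNonzeroPath n k t c := by
  refine ⟨fun hne => ⟨?_, ?_⟩, fun ⟨hc, hpath⟩ hzero => ?_⟩
  · exact not_lt.1 fun hc => hne (gen_smul_of_lt hc)
  · refine h.ne_zero_iff.1 fun hzero => hne ?_
    rw [hzero, MulOpposite.op_zero, zero_smul]
  · rw [gen_smul, Submodule.Quotient.mk_eq_zero] at hzero
    have := h.idem_mul_mul_idem_eq_zero_of_mem hc hzero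
    rw [h.idem_mul, h.mul_idem] at this
    exact h.ne_zero_iff.2 hpath this

theorem gen_smul_eq_zero_iff (h : IsPathBasis K n k r) :
    gen r t l <• r t c = 0 ↔ (l ≤ c → ¬ IsNonzeroPath n k t c) := by
  rw [← not_iff_not, ← ne_eq, h.gen_smul_ne_zero_iff, Classical.not_imp, not_not]

theorem exists_smul_idem_eq (h : IsPathBasis K n k r) (c : ℕ) (x : UniserialModule r t l) :
    ∃ κ : K, x <• r c c = κ • (gen r t l <• r t c) := by
  obtain ⟨a, rfl⟩ := exists_gen_smul x
  obtain ⟨κ, hκ⟩ := h.exists_smul_eq t c a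
  refine ⟨κ, ?_⟩
  calc gen r t l <• a <• r c c = gen r t l <• (r t t * a * r c c) := by
        rw [op_smul_mul, op_smul_mul, gen_smul_idem]
    _ = κ • (gen r t l <• r t c) := by rw [hκ, MulOpposite.op_smul, smul_assoc]

/-- Multiplication by the path from `t` to `q`, as a homomorphism of uniserial modules. -/
def pathHom (h : IsPathBasis K n k r) (q t : ℕ) (hl : l' ≤ l) :
    UniserialModule r q l' →ₗ[Aᵐᵒᵖ] UniserialModule r t l :=
  desc (gen r t l <• r t q) (by rw [← op_smul_mul, h.mul_idem]) fun c hc => by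
    rw [← op_smul_mul, h.mul_eq_ite]
    split_ifs
    · exact gen_smul_of_lt (hc.trans_le hl)
    · rw [MulOpposite.op_zero, zero_smul]

theorem pathHom_gen (h : IsPathBasis K n k r) (hl : l' ≤ l) :
    h.pathHom q t hl (gen r q l') = gen r t l <• r t q :=
  desc_gen ..

theorem pathHom_gen_smul (h : IsPathBasis K n k r) (hl : l' ≤ l) (hqt : q ≤ t) (hcq : c ≤ q) :
    h.pathHom q t hl (gen r q l' <• r q c) = gen r t l <• r t c := by
  rw [map_smul_right, pathHom_gen, ← op_smul_mul, h.mul hcq hqt]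

theorem pathHom_surjective (h : IsPathBasis K n k r) (hl : l' ≤ l) :
    Function.Surjective (h.pathHom t t hl) := by
  intro y
  obtain ⟨a, rfl⟩ := exists_gen_smul y
  exact ⟨gen r t l' <• a, by rw [map_smul_right, pathHom_gen, gen_smul_idem]⟩

theorem pathHom_injective (h : IsPathBasis K n k r) (hqt : q ≤ t)
    (hpath : ∀ c, l ≤ c → IsNonzeroPath n k q c → IsNonzeroPath n k t c) :
    Function.Injective (h.pathHom q t (le_refl l)) := by
  refine (injective_iff_map_eq_zero _).2 fun x hx => ?_
  rw [← h.sum_smul_idem x]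
  refine Finset.sum_eq_zero fun c _ => ?_
  obtain ⟨κ, hκ⟩ := h.exists_smul_idem_eq c x
  rw [hκ]
  by_cases hc : l ≤ c ∧ IsNonzeroPath n k q c
  · have hzero := congrArg (h.pathHom q t (le_refl l)) hκ
    rw [map_smul_right, hx, smul_zero, LinearMap.map_smul_of_tower,
      h.pathHom_gen_smul _ hqt hc.2.1] at hzero
    rw [(smul_eq_zero.1 hzero.symm).resolve_right
      (h.gen_smul_ne_zero_iff.2 ⟨hc.1, hpath c hc.1 hc.2⟩), zero_smul]
  · rw [h.gen_smul_eq_zero_iff.2 (not_and.1 hc), smul_zero]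

theorem pathHom_injective_of_le (h : IsPathBasis K n k r) (hk : k ≤ q + 1) (hqt : q ≤ t)
    (htn : t < n) : Function.Injective (h.pathHom q t (le_refl l)) := by
  refine h.pathHom_injective hqt fun c _ hpath => ?_
  have := hpath.2.2
  exact ⟨hpath.1.trans hqt, htn, .inr (by omega)⟩

theorem exact_pathHom (h : IsPathBasis K n k r) (hqt : q ≤ t) (hl : l ≤ q + 1) :
    Function.Exact (h.pathHom q t (le_refl l)) (h.pathHom t t hl) := by
  refine LinearMap.exact_iff.2 (le_antisymm (fun y hy => ?_) (LinearMap.range_le_ker_iff.2 ?_))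
  · rw [← h.sum_smul_idem y]
    refine Submodule.sum_mem _ fun c _ => ?_
    obtain ⟨κ, hκ⟩ := h.exists_smul_idem_eq c y
    obtain hcq | hqc := le_or_gt c q
    · exact ⟨κ • (gen r q l <• r q c), by
        rw [LinearMap.map_smul_of_tower, h.pathHom_gen_smul _ hqt hcq, hκ]⟩
    · have hzero := congrArg (h.pathHom t t hl) hκ
      rw [map_smul_right, LinearMap.mem_ker.1 hy, smul_zero, LinearMap.map_smul_of_tower,
        map_smul_right, pathHom_gen, gen_smul_idem] at hzero
      rw [hκ]
      obtain rfl | hne := smul_eq_zero.1 hzero.symm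
      · rw [zero_smul]
        exact Submodule.zero_mem _
      · rw [h.gen_smul_eq_zero_iff.2 fun _ => h.gen_smul_eq_zero_iff.1 hne hqc, smul_zero]
        exact Submodule.zero_mem _
  · refine hom_ext ?_
    rw [LinearMap.comp_apply, pathHom_gen, map_smul_right, pathHom_gen, gen_smul_idem,
      gen_smul_of_lt q.lt_succ_self, LinearMap.zero_apply]

theorem smul_smul_idem_eq [Module K M] [IsScalarTower K Aᵐᵒᵖ M] {j : ℕ} {x : A} {κ : K}
    (hκ : r j j * x * r j j = κ • r j j) {m : M} (hm : m <• r j j = m) :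
    m <• x <• r j j = κ • m := by
  calc m <• x <• r j j = m <• (r j j * x * r j j) := by rw [op_smul_mul, op_smul_mul, hm]
    _ = κ • m := by rw [hκ, MulOpposite.op_smul, smul_assoc, hm]

theorem uniserialModule_smul_idem (h : IsPathBasis K n k r) (x : UniserialModule r t t) :
    x <• r t t = x := by
  have hzero (c : ℕ) (hc : ¬(c = t ∧ t < n)) : x <• r c c = 0 := by
    obtain ⟨κ, hκ⟩ := h.exists_smul_idem_eq c x
    rw [hκ, h.gen_smul_eq_zero_iff.2 fun htc hpath => hc ⟨hpath.1.antisymm htc, hpath.2.1⟩,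
      smul_zero]
  conv_rhs => rw [← h.sum_smul_idem x]
  exact (Finset.sum_eq_single (f := fun c => x <• r c c) t (fun c _ hc => hzero c fun h => hc h.1)
    fun ht => hzero t fun h => ht (Finset.mem_range.2 h.2)).symm

theorem gen_ne_zero (h : IsPathBasis K n k r) (ht : t < n) (hl : l ≤ t) : gen r t l ≠ 0 := by
  rw [← gen_smul_idem]
  exact h.gen_smul_ne_zero_iff.2 ⟨hl, le_rfl, ht, .inl t.le_succ⟩

/-- The simple module at a vertex is one-dimensional. -/
noncomputable def uniserialModuleEquiv (h : IsPathBasis K n k r) (ht : t < n) :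
    K ≃ₗ[K] UniserialModule r t t :=
  .ofBijective (LinearMap.toSpanSingleton K _ (gen r t t))
    ⟨smul_left_injective K (h.gen_ne_zero ht le_rfl), fun x => by
      obtain ⟨κ, hκ⟩ := h.exists_smul_idem_eq t x
      exact ⟨κ, by
        rw [LinearMap.toSpanSingleton_apply, ← h.uniserialModule_smul_idem x, hκ, gen_smul_idem]⟩⟩

/-- A linear equivalence between two modules concentrated at a single vertex, that is, fixed by
the trivial path there, is an isomorphism of modules. -/
def equivOfConcentrated (h : IsPathBasis K n k r) [Module K M] [IsScalarTower K Aᵐᵒᵖ M]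
    [Module K N] [IsScalarTower K Aᵐᵒᵖ N] (j : ℕ) (hM : ∀ m : M, m <• r j j = m)
    (hN : ∀ m : N, m <• r j j = m) (e : M ≃ₗ[K] N) : M ≃ₗ[Aᵐᵒᵖ] N where
  __ := e
  map_smul' x m := by
    obtain ⟨κ, hκ⟩ := h.exists_smul_eq j j x.unop
    have hxm := smul_smul_idem_eq hκ (hM m)
    have hxe := smul_smul_idem_eq hκ (hN (e m))
    rw [hM, MulOpposite.op_unop] at hxm
    rw [hN, MulOpposite.op_unop] at hxe
    exact (congrArg e hxm).trans ((map_smul e κ m).trans hxe.symm)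

theorem exists_finsupp_equiv (h : IsPathBasis K n k r) {M : Type u} [AddCommGroup M]
    [Module Aᵐᵒᵖ M] [Module K M] [IsScalarTower K Aᵐᵒᵖ M] {j : ℕ} (hj : j < n)
    (hM : ∀ m : M, m <• r j j = m) :
    ∃ ι : Type u, Nonempty ((ι →₀ UniserialModule r j j) ≃ₗ[Aᵐᵒᵖ] M) :=
  ⟨_, ⟨h.equivOfConcentrated j (fun m => Finsupp.ext fun i => h.uniserialModule_smul_idem (m i)) hM
    ((Finsupp.mapRange.linearEquiv (h.uniserialModuleEquiv hj)).symm ≪≫ₗ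
      (Module.Basis.ofVectorSpace K M).repr.symm)⟩⟩

theorem projective_uniserialModule (h : IsPathBasis K n k r)
    (hpath : ∀ c < l, ¬ IsNonzeroPath n k t c) :
    Module.Projective Aᵐᵒᵖ (UniserialModule r t l) := by
  refine .of_split (M := Aᵐᵒᵖ) (desc (MulOpposite.op (r t t)) ?_ fun c hc => ?_)
    (LinearMap.toSpanSingleton Aᵐᵒᵖ _ (gen r t l)) (hom_ext ?_)
  · rw [smul_eq_mul, ← MulOpposite.op_mul, h.idem_mul]
  · rw [smul_eq_mul, ← MulOpposite.op_mul, h.idem_mul, h.eq_zero_iff.2 (hpath c hc),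
      MulOpposite.op_zero]
  · rw [LinearMap.comp_apply, desc_gen, LinearMap.toSpanSingleton_apply, gen_smul_idem,
      LinearMap.id_apply]

theorem projective_uniserialModule_zero (h : IsPathBasis K n k r) (t : ℕ) :
    Module.Projective Aᵐᵒᵖ (UniserialModule r t 0) :=
  h.projective_uniserialModule fun c hc => absurd hc c.not_lt_zero

theorem not_projective_uniserialModule (h : IsPathBasis K n k r) (hl : l ≤ t) (hc : c < l)
    (hpath : IsNonzeroPath n k t c) : ¬ Module.Projective Aᵐᵒᵖ (UniserialModule r t l) := by
  intro _
  obtain ⟨σ, hσ⟩ := Module.projective_lifting_property (h.pathHom t t l.zero_le)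
    (LinearMap.id (M := UniserialModule r t l)) (h.pathHom_surjective l.zero_le)
  obtain ⟨κ, hκ⟩ := h.exists_smul_idem_eq t (σ (gen r t l))
  rw [← map_smul_right, gen_smul_idem, gen_smul_idem] at hκ
  have hker : κ • (gen r t 0 <• r t c) = 0 := by
    rw [smul_comm, ← hκ, ← map_smul_right, gen_smul_of_lt hc, map_zero]
  have hκ0 := (smul_eq_zero.1 hker).resolve_right (h.gen_smul_ne_zero_iff.2 ⟨c.zero_le, hpath⟩)
  refine h.gen_ne_zero hpath.2.1 hl ?_
  have hgen := LinearMap.congr_fun hσ (gen r t l)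
  rwa [LinearMap.comp_apply, hκ, hκ0, zero_smul, map_zero, LinearMap.id_apply, eq_comm] at hgen

theorem pathHom_self (h : IsPathBasis K n k r) : h.pathHom t t (le_refl l) = .id :=
  hom_ext (by rw [pathHom_gen, gen_smul_idem, LinearMap.id_apply])

theorem pathHom_comp (h : IsPathBasis K n k r) {s l'' : ℕ} (hl : l' ≤ l) (hl' : l'' ≤ l')
    (hsq : s ≤ q) (hqt : q ≤ t) :
    h.pathHom q t hl ∘ₗ h.pathHom s q hl' = h.pathHom s t (hl'.trans hl) :=
  hom_ext (by rw [LinearMap.comp_apply, pathHom_gen, h.pathHom_gen_smul hl hqt hsq, pathHom_gen])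

theorem pathHom_eq_zero_iff (h : IsPathBasis K n k r) (hl : l' ≤ l) :
    h.pathHom q t hl = 0 ↔ (l ≤ q → ¬ IsNonzeroPath n k t q) := by
  rw [← h.gen_smul_eq_zero_iff, ← h.pathHom_gen hl]
  exact ⟨fun hzero => by rw [hzero, LinearMap.zero_apply], fun hzero => hom_ext hzero⟩

theorem exists_map_gen_eq (h : IsPathBasis K n k r)
    (f : UniserialModule r q l' →ₗ[Aᵐᵒᵖ] UniserialModule r t l) :
    ∃ κ : K, f (gen r q l') = κ • (gen r t l <• r t q) := by
  obtain ⟨κ, hκ⟩ := h.exists_smul_idem_eq q (f (gen r q l'))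
  exact ⟨κ, by rw [← hκ, ← map_smul_right, gen_smul_idem]⟩

theorem exists_eq_smul_pathHom (h : IsPathBasis K n k r) (hl : l' ≤ l)
    (f : UniserialModule r q l' →ₗ[Aᵐᵒᵖ] UniserialModule r t l) :
    ∃ κ : K, f = κ • h.pathHom q t hl := by
  obtain ⟨κ, hκ⟩ := h.exists_map_gen_eq f
  exact ⟨κ, hom_ext (by rw [hκ, LinearMap.smul_apply, pathHom_gen])⟩

theorem hom_eq_zero_of_not_isNonzeroPath (h : IsPathBasis K n k r)
    (hpath : ¬ IsNonzeroPath n k t q)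
    (f : UniserialModule r q l' →ₗ[Aᵐᵒᵖ] UniserialModule r t l) : f = 0 := by
  obtain ⟨κ, hκ⟩ := h.exists_map_gen_eq f
  exact hom_ext (by
    rw [hκ, h.gen_smul_eq_zero_iff.2 fun _ => hpath, smul_zero, LinearMap.zero_apply])

theorem hom_eq_zero_of_lt (h : IsPathBasis K n k r) (hqt : q ≤ t) (hlc : l ≤ c) (hcl' : c < l')
    (hcq : c ≤ q) (hpath : IsNonzeroPath n k t c)
    (f : UniserialModule r q l' →ₗ[Aᵐᵒᵖ] UniserialModule r t l) : f = 0 := by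
  obtain ⟨κ, hκ⟩ := h.exists_map_gen_eq f
  have hzero : κ • (gen r t l <• r t c) = 0 := by
    rw [← h.mul hcq hqt, op_smul_mul, smul_comm, ← hκ, ← map_smul_right, gen_smul_of_lt hcl',
      map_zero]
  have hκ0 := (smul_eq_zero.1 hzero).resolve_right (h.gen_smul_ne_zero_iff.2 ⟨hlc, hpath⟩)
  exact hom_ext (by rw [hκ, hκ0, zero_smul, LinearMap.zero_apply])

theorem exists_extension_of_pathHom (h : IsPathBasis K n k r) {t' : ℕ} (hqt : q ≤ t)
    (hpath : t' = t ∨ ¬ IsNonzeroPath n k t' q)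
    (φ : UniserialModule r q 0 →ₗ[Aᵐᵒᵖ] UniserialModule r t' l) :
    ∃ ψ : UniserialModule r t 0 →ₗ[Aᵐᵒᵖ] UniserialModule r t' l,
      ψ ∘ₗ h.pathHom q t le_rfl = φ := by
  obtain rfl | hzero := hpath
  · obtain ⟨κ, rfl⟩ := h.exists_eq_smul_pathHom l.zero_le φ
    exact ⟨κ • h.pathHom t' t' l.zero_le, by
      rw [LinearMap.smul_comp, h.pathHom_comp _ _ hqt le_rfl]⟩
  · exact ⟨0, by rw [LinearMap.zero_comp, h.hom_eq_zero_of_not_isNonzeroPath hzero φ]⟩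

theorem gen_smul_idem_of_ne (h : IsPathBasis K n k r) (hc : t ≠ c) :
    gen r t l <• r c c = 0 := by
  rw [← gen_smul_idem, ← op_smul_mul, h.mul_of_ne hc, MulOpposite.op_zero, zero_smul]

/-- The decomposition of the regular right module into indecomposable projective modules. -/
noncomputable def regularModuleEquiv (h : IsPathBasis K n k r) :
    A ≃ₗ[Aᵐᵒᵖ] ∀ j : Fin n, UniserialModule r j 0 :=
  .ofLinearMap (LinearMap.pi fun j => orbitMap A (gen r j 0))
    (LinearMap.lsum Aᵐᵒᵖ _ ℕ fun j => desc (r j j) (h.idem_mul j j) fun c hc =>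
      absurd hc c.not_lt_zero)
    (by
      refine LinearMap.pi_ext' fun i => hom_ext (funext fun j => ?_)
      simp only [LinearMap.comp_apply, LinearMap.coe_single, LinearMap.lsum_piSingle, desc_gen,
        LinearMap.pi_apply, orbitMap_apply, LinearMap.id_apply]
      obtain rfl | hij := eq_or_ne j i
      · rw [gen_smul_idem, Pi.single_eq_same]
      · rw [h.gen_smul_idem_of_ne (Fin.val_ne_of_ne hij), Pi.single_eq_of_ne hij])
    (LinearMap.ext fun a => by
      simp only [LinearMap.comp_apply, LinearMap.lsum_apply, LinearMap.sum_apply,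
        LinearMap.proj_apply, LinearMap.pi_apply, orbitMap_apply, map_smul_right, desc_gen,
        op_smul_eq_mul, LinearMap.id_apply]
      rw [← Finset.sum_mul, ← Finset.sum_range fun j => r j j, h.sum_eq_one, one_mul])

section GlobalDimension

variable {K : Type*} {A : Type u} [Field K] [Ring A] [Algebra K A] {n k : ℕ} {r : ℕ → ℕ → A}
  {j d : ℕ}

theorem hasProjectiveDimensionLT_simple_of_lt (h : IsPathBasis K n k r) (ι : Type u) (hjk : j < k)
    (hjn : j < n) :
    HasProjectiveDimensionLT (ModuleCat.of Aᵐᵒᵖ (ι →₀ UniserialModule r j j)) (j + 1) := by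
  induction j with
  | zero =>
    have := h.projective_uniserialModule_zero 0
    exact hasProjectiveDimensionLT_succ_of_projective 0
  | succ j ih =>
    have := h.projective_uniserialModule (l := j) (t := j + 1) fun c hc hpath => by
      have := hpath.2.2
      omega
    refine hasProjectiveDimensionLT_finsupp_succ_of_exact ι
      (h.pathHom_injective j.le_succ fun c hc hpath => ?_) (h.exact_pathHom j.le_succ j.le_succ)
      (h.pathHom_surjective _) _ (ih (by omega) (by omega))
    exact ⟨hpath.1.trans j.le_succ, hjn, .inl (by omega)⟩

theorem hasProjectiveDimensionLT_simple_of_ge (h : IsPathBasis K n k r) (ι : Type u) (hk : 0 < k)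
    (hkj : k ≤ j) (hjn : j < n) :
    HasProjectiveDimensionLT (ModuleCat.of Aᵐᵒᵖ (ι →₀ UniserialModule r j j)) 2 := by
  obtain ⟨j, rfl⟩ := Nat.exists_eq_add_one.2 (hk.trans_le hkj)
  have := h.projective_uniserialModule_zero
  refine hasProjectiveDimensionLT_finsupp_succ_of_exact ι
    (h.pathHom_injective_of_le hkj j.le_succ hjn) (h.exact_pathHom j.le_succ (j + 1).zero_le)
    (h.pathHom_surjective _) 1 (hasProjectiveDimensionLT_succ_of_projective 0)

theorem hasProjectiveDimensionLT_simple (h : IsPathBasis K n k r) (hk : 2 ≤ k) (ι : Type u)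
    (hjn : j < n) :
    HasProjectiveDimensionLT (ModuleCat.of Aᵐᵒᵖ (ι →₀ UniserialModule r j j)) k := by
  obtain hjk | hkj := lt_or_ge j k
  · have := h.hasProjectiveDimensionLT_simple_of_lt ι hjk hjn
    exact hasProjectiveDimensionLT_of_ge _ (j + 1) k hjk
  · have := h.hasProjectiveDimensionLT_simple_of_ge ι (two_pos.trans_le hk) hkj hjn
    exact hasProjectiveDimensionLT_of_ge _ 2 k hk

/-- In a module supported at the vertices up to `j`, the submodule of the elements that vanish
at `j`. -/
def vanishingSubmodule (h : IsPathBasis K n k r) {M : Type*} [AddCommGroup M] [Module Aᵐᵒᵖ M]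
    (j : ℕ) (hM : ∀ (m : M) (c : ℕ), j < c → m <• r c c = 0) : Submodule Aᵐᵒᵖ M where
  carrier := {m | m <• r j j = 0}
  add_mem' {x y} hx hy := (smul_add _ x y).trans (by rw [hx, hy, add_zero])
  zero_mem' := smul_zero _
  smul_mem' x m hm := by
    change m <• x.unop <• r j j = 0
    rw [← h.sum_smul_idem m, Finset.smul_sum, Finset.smul_sum]
    refine Finset.sum_eq_zero fun c _ => ?_
    obtain hcj | rfl | hjc := lt_trichotomy c j
    · obtain ⟨κ, hκ⟩ := h.exists_smul_eq c j x.unop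
      rw [← op_smul_mul, ← op_smul_mul, ← mul_assoc, hκ, h.eq_zero_of_lt hcj, smul_zero,
        MulOpposite.op_zero, zero_smul]
    · rw [show m <• r c c = 0 from hm, smul_zero, smul_zero]
    · rw [hM m c hjc, smul_zero, smul_zero]

theorem quotient_vanishingSubmodule_smul_idem (h : IsPathBasis K n k r) {M : Type*}
    [AddCommGroup M] [Module Aᵐᵒᵖ M] (hM : ∀ (m : M) (c : ℕ), j < c → m <• r c c = 0)
    (x : M ⧸ h.vanishingSubmodule j hM) : x <• r j j = x := by
  obtain ⟨m, rfl⟩ := Submodule.Quotient.mk_surjective _ x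
  rw [← Submodule.Quotient.mk_smul, Submodule.Quotient.eq]
  change (m <• r j j - m) <• r j j = 0
  rw [smul_sub, ← op_smul_mul, h.idem_mul, sub_self]

theorem hasProjectiveDimensionLT_of_supported (h : IsPathBasis K n k r)
    (hsimple : ∀ j < n, ∀ ι : Type u,
      HasProjectiveDimensionLT (ModuleCat.of Aᵐᵒᵖ (ι →₀ UniserialModule r j j)) d)
    (hj : j ≤ n) (M : Type u) [AddCommGroup M] [Module Aᵐᵒᵖ M] [Module K M]
    [IsScalarTower K Aᵐᵒᵖ M] (hM : ∀ (m : M) (c : ℕ), j ≤ c → m <• r c c = 0) :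
    HasProjectiveDimensionLT (ModuleCat.of Aᵐᵒᵖ M) d := by
  induction j generalizing M with
  | zero =>
    have : Subsingleton M := subsingleton_of_forall_eq 0 fun m => by
      rw [← h.sum_smul_idem m]
      exact Finset.sum_eq_zero fun c _ => hM m c c.zero_le
    have := (ModuleCat.isZero_of_subsingleton (ModuleCat.of Aᵐᵒᵖ M)).hasProjectiveDimensionLT_zero
    exact hasProjectiveDimensionLT_of_ge _ 0 d d.zero_le
  | succ j ih =>
    let V := h.vanishingSubmodule j hM
    have hV : HasProjectiveDimensionLT (ModuleCat.of Aᵐᵒᵖ V) d := by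
      refine ih (Nat.le_of_succ_le hj) V fun m c hc => Subtype.ext ?_
      obtain rfl | hlt := hc.eq_or_lt
      · exact m.2
      · exact hM m c hlt
    have hQ : HasProjectiveDimensionLT (ModuleCat.of Aᵐᵒᵖ (M ⧸ V)) d := by
      obtain ⟨ι, ⟨e⟩⟩ := h.exists_finsupp_equiv hj (h.quotient_vanishingSubmodule_smul_idem hM)
      have := hsimple j hj ι
      exact hasProjectiveDimensionLT_of_iso e.toModuleIso d
    exact (shortExact_of_linearMap V.injective_subtype (LinearMap.exact_subtype_mkQ V)
      V.mkQ_surjective).hasProjectiveDimensionLT_X₂ d hV hQ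

theorem hasProjectiveDimensionLT (h : IsPathBasis K n k r) (hk : 2 ≤ k) (M : ModuleCat.{u} Aᵐᵒᵖ) :
    HasProjectiveDimensionLT M k := by
  let := Module.compHom M (algebraMap K Aᵐᵒᵖ)
  have : IsScalarTower K Aᵐᵒᵖ M := ⟨fun κ a m => by
    rw [Algebra.smul_def, mul_smul]
    rfl⟩
  refine h.hasProjectiveDimensionLT_of_supported
    (fun j hj ι => h.hasProjectiveDimensionLT_simple hk ι hj) le_rfl M fun m c hc => ?_
  rw [h.eq_zero_iff.2 fun hpath => hc.not_gt hpath.2.1, MulOpposite.op_zero, zero_smul]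

theorem not_hasProjectiveDimensionLT_simple (h : IsPathBasis K n k r) (hj : j + 1 < k)
    (hjn : j + 1 < n) :
    ¬ HasProjectiveDimensionLT (ModuleCat.of Aᵐᵒᵖ (UniserialModule r (j + 1) (j + 1))) (j + 1) := by
  induction j with
  | zero =>
    rw [← projective_iff_hasProjectiveDimensionLT_one, ← IsProjective.iff_projective]
    exact h.not_projective_uniserialModule le_rfl one_pos ⟨zero_le_one, hjn, .inl le_rfl⟩
  | succ j ih =>
    have hproj := h.projective_uniserialModule (l := j + 1) (t := j + 2) fun c hc hpath => by
      have := hpath.2.2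
      omega
    rw [(shortExact_of_linearMap (h.pathHom_injective (j + 1).le_succ fun c hc hpath =>
        ⟨hpath.1.trans (j + 1).le_succ, hjn, .inl (by omega)⟩)
      (h.exact_pathHom (j + 1).le_succ (j + 1).le_succ)
      (h.pathHom_surjective _)).hasProjectiveDimensionLT_X₃_iff j
      ((IsProjective.iff_projective _).1 hproj)]
    exact ih (by omega) (by omega)

theorem globalDimension_eq (h : IsPathBasis K n k r) (hk : 2 ≤ k) (hkn : k ≤ n) :
    globalDimension A = ((k - 1 : ℕ) : WithBot ℕ∞) := by
  obtain ⟨j, rfl⟩ := Nat.exists_eq_add_of_le' hk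
  refine le_antisymm (iSup_le fun M => ?_)
    (le_iSup_of_le (ModuleCat.of Aᵐᵒᵖ (UniserialModule r (j + 1) (j + 1))) ?_)
  · exact (projectiveDimension_le_iff M _).2 (h.hasProjectiveDimensionLT hk M)
  · rw [projectiveDimension_ge_iff]
    exact h.not_hasProjectiveDimensionLT_simple (by omega) (by omega)

end GlobalDimension

end IsPathBasis

/-! ### The tilting module -/

/-- The top of the `i`-th summand of the tilting module, see `TiltingModule`. -/
def tiltTop (n k i : ℕ) : ℕ :=
  if i + 1 < k then i else n - 1

/-- The lower bound on the vertices that support the `i`-th summand of the tilting module, see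
`TiltingModule`. -/
def tiltCut (k i : ℕ) : ℕ :=
  if i < k then 0 else i

/-- The `i`-th summand of the tilting module, see `TiltingModule`. -/
abbrev TiltingSummand {A : Type*} [Ring A] (n k : ℕ) (r : ℕ → ℕ → A) (i : ℕ) : Type _ :=
  UniserialModule r (tiltTop n k i) (tiltCut k i)

/-- The tilting module `P(0) ⊕ ⋯ ⊕ P(k - 2) ⊕ P(n - 1) ⊕ P(n - 1) / P(k - 1) ⊕ ⋯ ⊕
P(n - 1) / P(n - 2)` over `A(n, k)`, where `P(t)` is the indecomposable projective module at the
vertex `t`, counted from `0`. -/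
abbrev TiltingModule {A : Type*} [Ring A] (n k : ℕ) (r : ℕ → ℕ → A) : Type _ :=
  ∀ i : Fin n, TiltingSummand n k r i

section TiltArithmetic

variable {n k : ℕ} {a b : ℕ}

theorem tiltTop_of_lt (ha : a + 1 < k) : tiltTop n k a = a :=
  if_pos ha

theorem tiltTop_of_le (ha : k ≤ a + 1) : tiltTop n k a = n - 1 :=
  if_neg ha.not_gt

theorem tiltCut_of_lt (ha : a < k) : tiltCut k a = 0 :=
  if_pos ha

theorem tiltCut_of_le (ha : k ≤ a) : tiltCut k a = a :=
  if_neg ha.not_gt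

theorem le_tiltTop (ha : a < n) : a ≤ tiltTop n k a := by
  unfold tiltTop
  split_ifs <;> omega

theorem tiltTop_lt (ha : a < n) : tiltTop n k a < n := by
  unfold tiltTop
  split_ifs <;> omega

theorem tiltTop_le_tiltTop (hba : b ≤ a) (ha : a < n) : tiltTop n k b ≤ tiltTop n k a := by
  unfold tiltTop
  split_ifs <;> omega

theorem tiltCut_le : tiltCut k a ≤ a := by
  unfold tiltCut
  split_ifs <;> omega

theorem tiltCut_le_tiltCut (hba : b ≤ a) : tiltCut k b ≤ tiltCut k a := by
  unfold tiltCut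
  split_ifs <;> omega

theorem isNonzeroPath_succ_iff (hkn : k < n) (hba : b ≤ a) (ha : a < n) :
    IsNonzeroPath n (k + 1) a b ↔
      tiltCut k a ≤ tiltTop n k b ∧ IsNonzeroPath n k (tiltTop n k a) (tiltTop n k b) := by
  unfold IsNonzeroPath tiltTop tiltCut
  split_ifs <;> omega

end TiltArithmetic

namespace IsPathBasis

open UniserialModule

section Tilting

variable {K : Type*} {A : Type u} [Field K] [Ring A] [Algebra K A] {n k : ℕ} {r : ℕ → ℕ → A}
  {i j q t t' l : ℕ}

theorem subsingleton_ext_one_uniserialModule (h : IsPathBasis K n k r) (hk : k ≤ q + 1)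
    (hqt : q ≤ t) (htn : t < n) (hpath : t' = t ∨ ¬ IsNonzeroPath n k t' q) :
    Subsingleton (Abelian.Ext.{u} (ModuleCat.of Aᵐᵒᵖ (UniserialModule r t (q + 1)))
      (ModuleCat.of Aᵐᵒᵖ (UniserialModule r t' l)) 1) :=
  have := h.projective_uniserialModule_zero t
  subsingleton_ext_one_of_extends (h.pathHom_injective_of_le hk hqt htn)
    (h.exact_pathHom hqt (q + 1).zero_le) (h.pathHom_surjective _)
    (h.exists_extension_of_pathHom hqt hpath)

theorem hasProjectiveDimensionLT_two_uniserialModule (h : IsPathBasis K n k r) (hk : k ≤ q + 1)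
    (hqt : q ≤ t) (htn : t < n) :
    HasProjectiveDimensionLT (ModuleCat.of Aᵐᵒᵖ (UniserialModule r t (q + 1))) 2 :=
  have := h.projective_uniserialModule_zero
  hasProjectiveDimensionLT_succ_of_exact (h.pathHom_injective_of_le hk hqt htn)
    (h.exact_pathHom hqt (q + 1).zero_le) (h.pathHom_surjective _) 1
    (hasProjectiveDimensionLT_succ_of_projective 0)

theorem projective_tiltingSummand (h : IsPathBasis K n k r) (hi : i < k) :
    Module.Projective Aᵐᵒᵖ (TiltingSummand n k r i) := by
  unfold TiltingSummand
  rw [tiltCut_of_lt hi]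
  exact h.projective_uniserialModule_zero _

theorem hasProjectiveDimensionLT_tiltingModule (h : IsPathBasis K n k r) (hk : 0 < k) :
    HasProjectiveDimensionLT (ModuleCat.of Aᵐᵒᵖ (TiltingModule n k r)) 2 := by
  refine hasProjectiveDimensionLT_pi fun i => ?_
  obtain hik | hki := lt_or_ge i.1 k
  · have := h.projective_tiltingSummand hik
    exact hasProjectiveDimensionLT_succ_of_projective 1
  · obtain ⟨q, hq⟩ := Nat.exists_eq_add_one.2 (hk.trans_le hki)
    unfold TiltingSummand
    rw [tiltTop_of_le (Nat.le_succ_of_le hki), tiltCut_of_le hki, hq]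
    exact h.hasProjectiveDimensionLT_two_uniserialModule (hq ▸ hki) (by omega) (by omega)

theorem subsingleton_ext_one_tiltingModule (h : IsPathBasis K n k r) (hk : 0 < k) :
    Subsingleton (Abelian.Ext.{u} (ModuleCat.of Aᵐᵒᵖ (TiltingModule n k r))
      (ModuleCat.of Aᵐᵒᵖ (TiltingModule n k r)) 1) := by
  refine subsingleton_ext_pi fun i j => ?_
  obtain hik | hki := lt_or_ge i.1 k
  · have := h.projective_tiltingSummand hik
    have := (IsProjective.iff_projective (R := Aᵐᵒᵖ) _).1 this
    exact Abelian.Ext.subsingleton_of_projective _ _ 0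
  · obtain ⟨q, hq⟩ := Nat.exists_eq_add_one.2 (hk.trans_le hki)
    unfold TiltingSummand
    rw [tiltTop_of_le (Nat.le_succ_of_le hki), tiltCut_of_le hki, hq]
    refine h.subsingleton_ext_one_uniserialModule (hq ▸ hki) (by omega) (by omega) ?_
    obtain hjk | hkj := lt_or_ge (j.1 + 1) k
    · rw [tiltTop_of_lt hjk]
      exact .inr fun hpath => by
        have := hpath.1
        omega
    · exact .inl (tiltTop_of_le hkj)

theorem pathHom_tiltTop_injective (h : IsPathBasis K n k r) (hj : j < n) :
    Function.Injective (h.pathHom j (tiltTop n k j) (le_refl l)) := by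
  obtain hjk | hkj := lt_or_ge (j + 1) k
  · rw [tiltTop_of_lt hjk, pathHom_self]
    exact Function.injective_id
  · exact h.pathHom_injective_of_le hkj (le_tiltTop hj) (tiltTop_lt hj)

theorem exists_retract_tiltingModule {t l : ℕ} (i : Fin n) (ht : tiltTop n k i = t)
    (hl : tiltCut k i = l) :
    ∃ (f : UniserialModule r t l →ₗ[Aᵐᵒᵖ] TiltingModule n k r)
      (g : TiltingModule n k r →ₗ[Aᵐᵒᵖ] UniserialModule r t l), g ∘ₗ f = .id := by
  subst ht hl
  let X (i : Fin n) := TiltingSummand n k r i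
  exact ⟨.single Aᵐᵒᵖ X i, .proj i, LinearMap.proj_comp_single_same Aᵐᵒᵖ X i⟩

theorem inAdd_pi_tiltTop_zero (hk : 0 < k) (hkn : k ≤ n) :
    InAdd Aᵐᵒᵖ (TiltingModule n k r) (∀ j : Fin n, UniserialModule r (tiltTop n k j) 0) := by
  refine inAdd_pi fun j => ?_
  obtain hjk | hkj := lt_or_ge j.1 k
  · exact exists_retract_tiltingModule j rfl (tiltCut_of_lt hjk)
  · exact exists_retract_tiltingModule ⟨k - 1, by omega⟩
      ((tiltTop_of_le (by simp only; omega)).trans (tiltTop_of_le (Nat.le_succ_of_le hkj)).symm)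
      (tiltCut_of_lt (by simp only; omega))

theorem inAdd_pi_tiltTop_succ :
    InAdd Aᵐᵒᵖ (TiltingModule n k r)
      (∀ j : Fin n, UniserialModule r (tiltTop n k j) (j + 1 : ℕ)) := by
  refine inAdd_pi fun j => ?_
  by_cases hj : k ≤ j.1 + 1 ∧ j.1 + 1 < n
  · exact exists_retract_tiltingModule ⟨j + 1, hj.2⟩
      ((tiltTop_of_le (Nat.le_succ_of_le hj.1)).trans (tiltTop_of_le hj.1).symm)
      (tiltCut_of_le hj.1)
  · have : Subsingleton (UniserialModule r (tiltTop n k j) (j + 1 : ℕ)) :=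
      subsingleton_of_lt (by unfold tiltTop; split_ifs <;> omega)
    exact ⟨0, 0, LinearMap.ext fun x => Subsingleton.elim _ _⟩

theorem isTilting (h : IsPathBasis K n k r) (hk : 0 < k) (hkn : k ≤ n) :
    IsTilting A (TiltingModule n k r) where
  finite := .pi
  projectiveDimension_le_one := h.hasProjectiveDimensionLT_tiltingModule hk
  ext_self := h.subsingleton_ext_one_tiltingModule hk
  coresolution := by
    let f (j : Fin n) := h.pathHom j (tiltTop n k j) (Nat.le_refl 0)
    let g (j : Fin n) := h.pathHom (tiltTop n k j) (tiltTop n k j) (j + 1 : ℕ).zero_le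
    have hf : Function.Injective (LinearMap.piMap f) :=
      .piMap fun j => h.pathHom_tiltTop_injective j.2
    have hfg : Function.Exact (LinearMap.piMap f) (LinearMap.piMap g) :=
      exact_piMap fun j => h.exact_pathHom (le_tiltTop j.2) (j + 1 : ℕ).zero_le
    have hg : Function.Surjective (LinearMap.piMap g) :=
      .piMap fun j => h.pathHom_surjective (j + 1 : ℕ).zero_le
    refine ⟨.of Aᵐᵒᵖ (∀ j : Fin n, UniserialModule r (tiltTop n k j) 0),
      .of Aᵐᵒᵖ (∀ j : Fin n, UniserialModule r (tiltTop n k j) (j + 1 : ℕ)),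
      LinearMap.piMap f ∘ₗ h.regularModuleEquiv, LinearMap.piMap g, inAdd_pi_tiltTop_zero hk hkn,
      inAdd_pi_tiltTop_succ, hf.comp h.regularModuleEquiv.injective,
      h.regularModuleEquiv.surjective.comp_exact_iff_exact.2 hfg, hg⟩

end Tilting

section EndomorphismAlgebra

variable {K A : Type*} [Field K] [Ring A] [Algebra K A] {n k : ℕ} {r : ℕ → ℕ → A} {a b c : ℕ}

theorem hom_tiltingSummand_eq_zero (h : IsPathBasis K n k r) (hab : a < b) (hb : b < n)
    (f : TiltingSummand n k r b →ₗ[Aᵐᵒᵖ] TiltingSummand n k r a) : f = 0 := by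
  obtain hak | hka := lt_or_ge (a + 1) k
  · refine h.hom_eq_zero_of_not_isNonzeroPath (fun hpath => ?_) f
    exact (hab.trans_le (le_tiltTop hb)).not_ge (hpath.1.trans_eq (tiltTop_of_lt hak))
  · have hkb : k ≤ b := hka.trans hab
    have ha := hab.trans hb
    have htop : tiltTop n k b = tiltTop n k a :=
      (tiltTop_of_le (Nat.le_succ_of_le hkb)).trans (tiltTop_of_le hka).symm
    exact h.hom_eq_zero_of_lt htop.le tiltCut_le (hab.trans_eq (tiltCut_of_le hkb).symm)
      (hab.le.trans (le_tiltTop hb)) ⟨le_tiltTop ha, tiltTop_lt ha, .inr (Nat.le_succ_of_le hka)⟩ f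

/-- The endomorphism of the tilting module given by multiplication by a path from the `b`-th to
the `a`-th summand, with value `0` where `b ≤ a < n` fails. -/
noncomputable def tiltingEnd (h : IsPathBasis K n k r) (a b : ℕ) :
    Module.End Aᵐᵒᵖ (TiltingModule n k r) :=
  if hab : b ≤ a ∧ a < n then
    blockEnd (X := fun i : Fin n => TiltingSummand n k r i) ⟨a, hab.2⟩ ⟨b, hab.1.trans_lt hab.2⟩
      (h.pathHom (tiltTop n k b) (tiltTop n k a) (tiltCut_le_tiltCut hab.1))
  else 0

theorem tiltingEnd_of_le (h : IsPathBasis K n k r) (hba : b ≤ a) (ha : a < n) :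
    h.tiltingEnd a b =
      blockEnd (X := fun i : Fin n => TiltingSummand n k r i) ⟨a, ha⟩ ⟨b, hba.trans_lt ha⟩
        (h.pathHom (tiltTop n k b) (tiltTop n k a) (tiltCut_le_tiltCut hba)) :=
  dif_pos ⟨hba, ha⟩

theorem tiltingEnd_eq_zero (h : IsPathBasis K n k r) (hab : ¬ (b ≤ a ∧ a < n)) :
    h.tiltingEnd a b = 0 :=
  dif_neg hab

theorem tiltingEnd_ne_zero_iff (h : IsPathBasis K n k r) (hkn : k < n) :
    h.tiltingEnd a b ≠ 0 ↔ IsNonzeroPath n (k + 1) a b := by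
  by_cases hab : b ≤ a ∧ a < n
  · rw [h.tiltingEnd_of_le hab.1 hab.2, ne_eq, blockEnd_eq_zero_iff, h.pathHom_eq_zero_iff,
      isNonzeroPath_succ_iff hkn hab.1 hab.2, Classical.not_imp, not_not]
  · rw [h.tiltingEnd_eq_zero hab]
    exact iff_of_false (fun hne => hne rfl) fun hpath => hab ⟨hpath.1, hpath.2.1⟩

theorem tiltingEnd_mul (h : IsPathBasis K n k r) (hcb : c ≤ b) (hba : b ≤ a) :
    h.tiltingEnd a b * h.tiltingEnd b c = h.tiltingEnd a c := by
  by_cases ha : a < n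
  · have hb := hba.trans_lt ha
    rw [h.tiltingEnd_of_le hba ha, h.tiltingEnd_of_le hcb hb, h.tiltingEnd_of_le (hcb.trans hba) ha,
      blockEnd_mul, h.pathHom_comp _ _ (tiltTop_le_tiltTop hcb hb) (tiltTop_le_tiltTop hba ha)]
  · rw [h.tiltingEnd_eq_zero fun hab => ha hab.2, h.tiltingEnd_eq_zero fun hac => ha hac.2,
      zero_mul]

theorem tiltingEnd_mul_of_ne (h : IsPathBasis K n k r) {d : ℕ} (hbc : b ≠ c) :
    h.tiltingEnd a b * h.tiltingEnd c d = 0 := by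
  by_cases hab : b ≤ a ∧ a < n
  · by_cases hcd : d ≤ c ∧ c < n
    · rw [h.tiltingEnd_of_le hab.1 hab.2, h.tiltingEnd_of_le hcd.1 hcd.2,
        blockEnd_mul_of_ne fun hbc' => hbc (Fin.val_eq_of_eq hbc')]
    · rw [h.tiltingEnd_eq_zero hcd, mul_zero]
  · rw [h.tiltingEnd_eq_zero hab, zero_mul]

theorem sum_tiltingEnd (h : IsPathBasis K n k r) :
    ∑ a ∈ Finset.range n, h.tiltingEnd a a = 1 := by
  rw [Finset.sum_range, ← sum_blockEnd_id]
  exact Finset.sum_congr rfl fun a _ => by rw [h.tiltingEnd_of_le le_rfl a.2, pathHom_self]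

theorem blockEnd_mem_span_tiltingEnd (h : IsPathBasis K n k r) (a b : Fin n)
    (f : TiltingSummand n k r b →ₗ[Aᵐᵒᵖ] TiltingSummand n k r a) :
    blockEnd (X := fun i : Fin n => TiltingSummand n k r i) a b f ∈
      Submodule.span K (Set.range (Function.uncurry h.tiltingEnd)) := by
  obtain hba | hab := le_or_gt b.1 a.1
  · obtain ⟨κ, rfl⟩ := h.exists_eq_smul_pathHom (tiltCut_le_tiltCut hba) f
    rw [blockEnd_smul, ← h.tiltingEnd_of_le hba a.2]
    exact Submodule.smul_mem _ κ (Submodule.subset_span ⟨(a.1, b.1), rfl⟩)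
  · obtain rfl := h.hom_tiltingSummand_eq_zero hab b.2 f
    rw [blockEnd_eq_zero_iff.2 rfl]
    exact Submodule.zero_mem _

theorem isPathBasis_tiltingEnd (h : IsPathBasis K n k r) (hkn : k < n) :
    IsPathBasis K n (k + 1) h.tiltingEnd where
  ne_zero_iff := h.tiltingEnd_ne_zero_iff hkn
  mul := h.tiltingEnd_mul
  mul_of_ne := h.tiltingEnd_mul_of_ne
  sum_eq_one := h.sum_tiltingEnd
  span_eq_top := eq_top_iff.2 fun f _ => by
    rw [← sum_sum_blockEnd f]
    exact Submodule.sum_mem _ fun a _ => Submodule.sum_mem _ fun b _ =>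
      h.blockEnd_mem_span_tiltingEnd a b _

end EndomorphismAlgebra

theorem isEndOfTilting {K A B : Type u} [Field K] [Ring A] [Algebra K A] [Ring B] [Algebra K B]
    {n k : ℕ} {r : ℕ → ℕ → A} {s : ℕ → ℕ → B} (hr : IsPathBasis K n k r) (hk : 0 < k)
    (hkn : k < n) (hs : IsPathBasis K n (k + 1) s) : IsEndOfTilting K A B :=
  ⟨TiltingModule n k r, inferInstance, inferInstance, inferInstance, inferInstance,
    hr.isTilting hk hkn.le, ⟨(hr.isPathBasis_tiltingEnd hkn).algEquiv hs⟩⟩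

end IsPathBasis

end RightModules

theorem proposition5p1 (K : Type u) [Field K] (n : ℕ) (hn : 2 ≤ n) :
    (∀ k : ℕ, 2 ≤ k → k ≤ n →
      globalDimension (BoundAlgebra K n k) = ((k - 1 : ℕ) : WithBot ℕ∞)) ∧
    (∀ k : ℕ, 2 ≤ k → k < n →
      IsEndOfTilting K (BoundAlgebra K n k) (BoundAlgebra K n (k + 1))) ∧
    (∃ B : ℕ → AlgCat.{u} K,
      Nonempty (B 0 ≃ₐ[K] PathAlgebra K (LinearA n)) ∧ IsHereditary (B 0) ∧
      (∀ i : ℕ, i < n - 2 → IsEndOfTilting K (B i) (B (i + 1))) ∧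
      globalDimension (B (n - 2)) = ((n - 1 : ℕ) : WithBot ℕ∞)) := by
  have hdim (k : ℕ) (hk : 2 ≤ k) (hkn : k ≤ n) :
      globalDimension (BoundAlgebra K n k) = ((k - 1 : ℕ) : WithBot ℕ∞) :=
    BoundAlgebra.isPathBasis_pathElement.globalDimension_eq hk hkn
  have htilt (k : ℕ) (hk : 2 ≤ k) (hkn : k < n) :
      IsEndOfTilting K (BoundAlgebra K n k) (BoundAlgebra K n (k + 1)) :=
    BoundAlgebra.isPathBasis_pathElement.isEndOfTilting (two_pos.trans_le hk) hkn
      BoundAlgebra.isPathBasis_pathElement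
  refine ⟨hdim, htilt, fun i => .of K (BoundAlgebra K n (i + 2)), ?_, ?_, fun i hi => ?_, ?_⟩
  · exact ⟨BoundAlgebra.isPathBasis_pathElement.algEquiv (PathAlgebra.isPathBasis_pathElement K)⟩
  · exact isHereditary_of_globalDimension_le_one (hdim 2 le_rfl hn).le
  · exact htilt (i + 2) (Nat.le_add_left 2 i) (by omega)
  · rw [show n - 1 = n - 2 + 2 - 1 by omega]
    exact hdim (n - 2 + 2) (Nat.le_add_left 2 _) (Nat.sub_add_cancel hn).le
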